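/- Let $\mathbb D$ be the open unit disc, $H(\mathbb D)$ the space of analytic functions on $\mathbb D$, and $dm=\frac1\pi\,dx\,dy$. For an arc $I\subset\partial\mathbb D$ let $|I|\in(0,1]$ be its normalized length and $S(I)=\{z\in\mathbb D: 1-|I|\le|z|<1,\ z/|z|\in I\}$ its Carleson box (with $S(\partial\mathbb D)=\mathbb D$). All suprema over $I$ below are over all arcs $I\subset\partial\mathbb D$ with $|I|>0$. For $0<\lambda<1$, the analytic Morrey space $\mathcal L^{2,\lambda}$ is the set of all $f$ in the Hardy space $H^2$ of $\mathbb D$ with $$\sup_{I}\Big(\frac1{|I|^\lambda}\int_I|f(\zeta)-f_I|^2\frac{|d\zeta|}{2\pi}\Big)^{1/2}<\infty,\qquad f_I=\frac1{|I|}\int_I f(\zeta)\frac{|d\zeta|}{2\pi},$$ where $f(\zeta)$ denotes the radial boundary values of $f$; it is normed by $$\|f\|_{\mathcal L^{2,\lambda}}=|f(0)|+\sup_I\Big(\frac1{|I|^\lambda}\int_{S(I)}|f'(z)|^2(1-|z|^2)\,dm(z)\Big)^{1/2}.$$ The Bloch space $B$ consists of the $f\in H(\mathbb D)$ with $\sup_{z\in\mathbb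 D}(1-|z|^2)|f'(z)|<\infty$, normed by $|f(0)|+\sup_{z\in\mathbb D}(1-|z|^2)|f'(z)|$. For $p>1$ and $g\in H(\mathbb D)$ put $$M_p(g)=\sup_I\Big(\frac1{|I|^{p-\lambda+1}}\int_{S(I)}|g'(z)|^2(1-|z|^2)^p\,dm(z)\Big)^{1/2}\in[0,\infty],$$ and let $B\mathcal L^{p,\lambda}=\{g\in H(\mathbb D): M_p(g)<\infty\}$. Finally let $T_gf(z)=\int_0^z f(w)g'(w)\,dw$ for $z\in\mathbb D$. Theorem. Let $0<\lambda<1$ and $g\in H(\mathbb D)$. The following are equivalent: (i) $T_g:\mathcal L^{2,\lambda}\to B$ is bounded; (ii) $g\in B\mathcal L^{p,\lambda}$ for all $p\in(1,\infty)$; (iii) $g\in B\mathcal L^{p,\lambda}$ for some $p\in(1,\infty)$. Moreover, for every $p\in(1,\infty)$ there are constants $c,C\in(0,\infty)$, depending only on $p$ and $\lambda$, such that for every $g\in H(\mathbb D)$ $$c\,M_p(g)\le\|T_g\|\le C\,M_p(g),$$ where $\|T_g\|\in[0,\infty]$ is the supremum of $\|T_gf\|_B$ over all $f\in\mathcal L^{2,\lambda}$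 with $\|f\|_{\mathcal L^{2,\lambda}}\le1$. -/

import Mathlib

noncomputable section

namespace MorreyBloch

open Filter Topology MeasureTheory
open scoped ENNReal

/-- The open unit disc `𝔻` of the complex plane. -/
def disc : Set ℂ := Metric.ball 0 1

/-- `f ∈ H(𝔻)`: `f` is holomorphic on the unit disc. (Only the values of `f` on the disc
are ever used.) -/
def Holo (f : ℂ → ℂ) : Prop := DifferentiableOn ℂ f disc

/-- The normalized area measure `dm = dx dy / π`. -/
def area : Measure ℂ := ENNReal.ofReal (1 / Real.pi) • volume

/-- The (closed) arc `I = {e^{iθ} : α ≤ θ ≤ α + 2πh}` of the unit circle. For `0 < h ≤ 1` its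
normalized length is `|I| = h`, and every arc arises in this way. -/
def arc (α h : ℝ) : Set ℂ :=
  (fun θ : ℝ => circleMap 0 1 θ) '' Set.Icc α (α + 2 * Real.pi * h)

/-- The Carleson box `S(I) = {z ∈ 𝔻 : 1 - |I| ≤ |z| < 1, z / |z| ∈ I}` on the arc `I = arc α h`.
The condition on the argument is written `z = |z| ζ` with `ζ ∈ I`, so that `S(∂𝔻) = 𝔻`. -/
def carlesonBox (α h : ℝ) : Set ℂ :=
  {z : ℂ | z ∈ disc ∧ 1 - h ≤ ‖z‖ ∧ ∃ ζ ∈ arc α h, z = (‖z‖ : ℂ) * ζ}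

/-- The Hardy space `H²` of the disc. -/
def MemHardyTwo (f : ℂ → ℂ) : Prop :=
  Holo f ∧
    (⨆ r ∈ Set.Ioo (0 : ℝ) 1, ENNReal.ofReal (1 / (2 * Real.pi)) *
      ∫⁻ θ in Set.Ioc 0 (2 * Real.pi), ‖f (circleMap 0 r θ)‖ₑ ^ 2) < ∞

/-- `F` is the boundary function of `f`: for almost every point `ζ` of the unit circle, `F ζ` is
the radial limit of `f` at `ζ`. Such an `F` is unique up to null sets. -/
def IsBoundaryFunction (f F : ℂ → ℂ) : Prop :=
  ∀ᵐ θ : ℝ, Tendsto (fun r : ℝ => f (circleMap 0 r θ)) (𝓝[<] 1) (𝓝 (F (circleMap 0 1 θ)))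

/-- The mean `F_I = (1/|I|) ∫_I F(ζ) |dζ| / 2π` over the arc `I = arc α h`. -/
def arcMean (F : ℂ → ℂ) (α h : ℝ) : ℂ :=
  ((1 / h * (1 / (2 * Real.pi)) : ℝ) : ℂ) *
    ∫ θ in Set.Icc α (α + 2 * Real.pi * h), F (circleMap 0 1 θ)

/-- `((1/|I|^lam) ∫_I |F(ζ) - F_I|² |dζ| / 2π)^{1/2}` for the arc `I = arc α h`. -/
def arcOscillation (lam : ℝ) (F : ℂ → ℂ) (α h : ℝ) : ℝ≥0∞ :=
  ((ENNReal.ofReal (1 / (2 * Real.pi)) *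
      ∫⁻ θ in Set.Icc α (α + 2 * Real.pi * h),
        ‖F (circleMap 0 1 θ) - arcMean F α h‖ₑ ^ 2) /
    ENNReal.ofReal (h ^ lam)) ^ (1 / 2 : ℝ)

/-- The analytic Morrey space `𝓛^{2,lam}`: the functions in `H²` whose boundary function has
bounded `lam`-scaled mean oscillation over all arcs. -/
def MemMorrey (lam : ℝ) (f : ℂ → ℂ) : Prop :=
  MemHardyTwo f ∧ ∃ F : ℂ → ℂ, IsBoundaryFunction f F ∧
    (⨆ (α : ℝ) (h ∈ Set.Ioc (0 : ℝ) 1), arcOscillation lam F α h) < ∞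

/-- `sup_I ((1/|I|^s) ∫_{S(I)} |f'(z)|² (1-|z|²)^q dm(z))^{1/2}`, the supremum being over all arcs
`I` of the unit circle. -/
def boxSeminorm (s q : ℝ) (f : ℂ → ℂ) : ℝ≥0∞ :=
  ⨆ (α : ℝ) (h ∈ Set.Ioc (0 : ℝ) 1),
    ((∫⁻ z in carlesonBox α h,
        ENNReal.ofReal (‖deriv f z‖ ^ 2 * (1 - ‖z‖ ^ 2) ^ q) ∂area) /
      ENNReal.ofReal (h ^ s)) ^ (1 / 2 : ℝ)

/-- The norm of `𝓛^{2,lam}`: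
`|f(0)| + sup_I ((1/|I|^lam) ∫_{S(I)} |f'(z)|² (1-|z|²) dm(z))^{1/2}`. -/
def morreyNorm (lam : ℝ) (f : ℂ → ℂ) : ℝ≥0∞ := ‖f 0‖ₑ + boxSeminorm lam 1 f

/-- The Bloch seminorm `sup_{z ∈ 𝔻} (1-|z|²) |f'(z)|`. -/
def blochSeminorm (f : ℂ → ℂ) : ℝ≥0∞ :=
  ⨆ z ∈ disc, ENNReal.ofReal ((1 - ‖z‖ ^ 2) * ‖deriv f z‖)

/-- The Bloch space `B`. -/
def MemBloch (f : ℂ → ℂ) : Prop := Holo f ∧ blochSeminorm f < ∞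

/-- The norm of the Bloch space, `|f(0)| + sup_{z ∈ 𝔻} (1-|z|²) |f'(z)|`. -/
def blochNorm (f : ℂ → ℂ) : ℝ≥0∞ := ‖f 0‖ₑ + blochSeminorm f

/-- The quantity
`M(g) = sup_I ((1/|I|^{p-lam+1}) ∫_{S(I)} |g'(z)|² (1-|z|²)^p dm(z))^{1/2}`. -/
def blochMorreyM (p lam : ℝ) (g : ℂ → ℂ) : ℝ≥0∞ := boxSeminorm (p - lam + 1) p g

/-- The Bloch–Morrey type space `B𝓛^{p,lam}`. -/
def MemBlochMorrey (p lam : ℝ) (g : ℂ → ℂ) : Prop := Holo g ∧ blochMorreyM p lam g < ∞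

/-- The Volterra type operator `T_g f(z) = ∫_0^z f(w) g'(w) dw`, the integral being taken along
the segment `w = t z`, `0 ≤ t ≤ 1`. -/
def volterra (g f : ℂ → ℂ) (z : ℂ) : ℂ :=
  ∫ t in (0 : ℝ)..1, f ((t : ℂ) * z) * deriv g ((t : ℂ) * z) * z

/-- `T_g : 𝓛^{2,lam} → B` is a bounded operator: it maps `𝓛^{2,lam}` into `B`, and there is a
finite constant `C` with `‖T_g f‖_B ≤ C ‖f‖` for all `f ∈ 𝓛^{2,lam}`. -/
def VolterraBounded (lam : ℝ) (g : ℂ → ℂ) : Prop :=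
  (∀ f, MemMorrey lam f → MemBloch (volterra g f)) ∧
    ∃ C : ℝ, 0 ≤ C ∧ ∀ f, MemMorrey lam f →
      blochNorm (volterra g f) ≤ ENNReal.ofReal C * morreyNorm lam f

/-- The operator norm of `T_g : 𝓛^{2,lam} → B`, that is the supremum of `‖T_g f‖_B` over the unit
ball of `𝓛^{2,lam}`, as an element of `[0, ∞]`. -/
def volterraNorm (lam : ℝ) (g : ℂ → ℂ) : ℝ≥0∞ :=
  ⨆ (f : ℂ → ℂ) (_ : MemMorrey lam f) (_ : morreyNorm lam f ≤ 1), blochNorm (volterra g f)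

end MorreyBloch

end

/-!
All quantities in the theorem are compared with one number, `N(g) = derivGrowth ((1+lam)/2) g`, the
supremum over the disc of `(1-|z|)^{(1+lam)/2} |g'(z)|`.

*`M_p(g)` and `N(g)`.* If `|g'|` is at most `N(g) (1-|z|)^{-(1+lam)/2}`, integration over a box on
an arc of length `h` gives a multiple of `N(g)² h^{p-lam+1}`, because `p - 1 - lam > -1`
(`boxSeminorm_le_derivGrowth`). Conversely each point `z` has a disc of radius `(1-|z|)/2` inside a
box of size comparable to `1-|z|`, and the sub-mean value property of `|g'|²` on that disc bounds
`|g'(z)|` by a multiple of `M_p(g) (1-|z|)^{-(1+lam)/2}` (`derivGrowth_le_boxSeminorm`). Since `N(g)`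
does not involve `p`, finiteness of `M_p(g)` does not depend on `p`.

*`‖T_g‖` and `N(g)`.* As `(T_g f)' = f g'`, the Bloch norm of `T_g f` is the supremum of
`(1-|z|²) |f(z)| |g'(z)|`. The norm of `𝓛^{2,lam}` is itself a box seminorm, so the same sub-mean
value argument bounds `f'`, and integration along radii gives
`|f(z)| ≤ C ‖f‖ (1-|z|)^{-(1-lam)/2}`; hence `‖T_g‖ ≤ C N(g)`. The order of growth is attained at any
prescribed point `w` by `(1 - w̄ z)^{-(1-lam)/2}`, whose norms are bounded uniformly in `w`
(`boxSeminorm_le_of_norm_deriv_le_kernel`), so that `N(g) ≤ C ‖T_g‖`.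

*Mapping property.* Membership in `𝓛^{2,lam}` is defined by the mean oscillation of the boundary
function `F`, whereas the norm is defined by area integrals. That `T_g` maps all of `𝓛^{2,lam}` into
the Bloch space is therefore derived from the oscillation directly (`MemMorrey.exists_norm_le`):
comparing each arc with its double gives `∫_I |F| = O(|I|^{(1+lam)/2})`, and Cauchy's formula, valid
with boundary values because the dilations of an `H²` function converge in `L¹`, turns this into
growth of order `(1-|z|)^{-(1-lam)/2}`.
-/

noncomputable section

namespace MorreyBloch

open Filter Topology MeasureTheory
open scoped ENNReal

/-! ### Integrals over Carleson boxes in polar coordinates -/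

lemma carlesonBox_subset_arg {α h : ℝ} (hh : h ∈ Set.Ioc (0 : ℝ) 1) :
    carlesonBox α h ⊆ {z : ℂ | ‖z‖ ∈ Set.Ico (1 - h) 1 ∧
      |(z * Complex.exp (-((α + Real.pi * h : ℝ) * Complex.I))).arg| ≤ Real.pi * h} := by
  rintro z ⟨hz, hz1, ζ, ⟨θ, hθ, rfl⟩, hzeq⟩
  have hz' : ‖z‖ < 1 := by simpa [disc] using hz
  refine ⟨⟨hz1, hz'⟩, ?_⟩
  have hπ := Real.pi_pos
  have e : z * Complex.exp (-((α + Real.pi * h : ℝ) * Complex.I)) =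
      (‖z‖ : ℂ) * Complex.exp ((θ - (α + Real.pi * h) : ℝ) * Complex.I) := by
    conv_lhs => rw [hzeq]
    simp only [circleMap, zero_add, Complex.ofReal_one, one_mul, mul_assoc]
    rw [← Complex.exp_add]
    push_cast
    ring_nf
  rw [e]
  rcases eq_or_lt_of_le (norm_nonneg z) with h0 | h0
  · rw [← h0]
    simp only [Complex.ofReal_zero, zero_mul, Complex.arg_zero, abs_zero]
    have := hh.1
    positivity
  set t := θ - (α + Real.pi * h) with ht
  have htle : |t| ≤ Real.pi * h := by
    rw [abs_le]
    constructor <;> linarith [hθ.1, hθ.2]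
  rw [Complex.arg_real_mul _ h0]
  have hh1 : Real.pi * h ≤ Real.pi := by nlinarith [hh.2]
  rcases eq_or_lt_of_le (show -Real.pi ≤ t by linarith [(abs_le.1 htle).1]) with h1 | h1
  · rw [← h1] at htle ⊢
    have : Complex.exp ((-Real.pi : ℝ) * Complex.I) = -1 := by
      push_cast
      rw [neg_mul, Complex.exp_neg, Complex.exp_pi_mul_I]
      norm_num
    rw [this, Complex.arg_neg_one]
    simpa using htle
  · rw [Complex.arg_exp_mul_I, (toIocMod_eq_self _).2]
    · exact htle
    · exact ⟨h1, by linarith [(abs_le.1 htle).2]⟩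

/-- Integration over a Carleson box in polar coordinates centred at the midpoint of its arc: an
integrand dominated by a product `A r * B θ` has integral at most the product of the integrals.
The factor `r` of the polar Jacobian is bounded by `1`. -/
lemma lintegral_carlesonBox_le {α h : ℝ} (hh : h ∈ Set.Ioc (0 : ℝ) 1) (F : ℂ → ℝ≥0∞)
    {A B : ℝ → ℝ≥0∞} (hA : Measurable A) (hB : Measurable B)
    (hF : ∀ r θ : ℝ, 0 < r → 1 - h ≤ r → r < 1 → |θ| ≤ Real.pi * h → |θ| < Real.pi →
      F (r * Complex.exp ((θ + (α + Real.pi * h) : ℝ) * Complex.I)) ≤ A r * B θ) :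
    ∫⁻ z in carlesonBox α h, F z ∂volume ≤
      (∫⁻ r in Set.Ico (1 - h) 1, A r) *
        ∫⁻ θ in Set.Icc (-(Real.pi * h)) (Real.pi * h), B θ := by
  set c : ℝ := α + Real.pi * h with hc
  set T : Set ℂ := {z : ℂ | ‖z‖ ∈ Set.Ico (1 - h) 1 ∧
      |(z * Complex.exp (-((c : ℝ) * Complex.I))).arg| ≤ Real.pi * h} with hT
  have hTm : MeasurableSet T := by
    apply MeasurableSet.inter
    · exact (measurableSet_Ico (a := 1 - h) (b := (1 : ℝ))).preimage
        (measurable_norm : Measurable fun z : ℂ => ‖z‖)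
    · exact measurableSet_le (f := fun z : ℂ =>
        |(z * Complex.exp (-((c : ℝ) * Complex.I))).arg|) (by fun_prop) measurable_const
  calc ∫⁻ z in carlesonBox α h, F z ∂volume ≤ ∫⁻ z in T, F z :=
        lintegral_mono_set (carlesonBox_subset_arg hh)
    _ = ∫⁻ z, T.indicator F z := (lintegral_indicator hTm _).symm
    _ = ∫⁻ z, T.indicator F (rotation (Circle.exp c) z) := by
        rw [(rotation (Circle.exp c)).measurePreserving.lintegral_comp_emb
          (rotation (Circle.exp c)).toHomeomorph.measurableEmbedding]
    _ = ∫⁻ p in polarCoord.target, ENNReal.ofReal p.1 •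
          T.indicator F (rotation (Circle.exp c) (Complex.polarCoord.symm p)) :=
        (Complex.lintegral_comp_polarCoord_symm _).symm
    _ ≤ ∫⁻ p in polarCoord.target, (Set.Ico (1 - h) 1).indicator A p.1 *
          (Set.Icc (-(Real.pi * h)) (Real.pi * h)).indicator B p.2 := by
        refine setLIntegral_mono' polarCoord.open_target.measurableSet ?_
        rintro ⟨r, θ⟩ ⟨hr, hθ⟩
        simp only [Set.mem_Ioi, Set.mem_Ioo] at hr hθ
        have hz : rotation (Circle.exp c) (Complex.polarCoord.symm (r, θ)) =
            r * Complex.exp ((θ + c : ℝ) * Complex.I) := by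
          rw [rotation_apply, Circle.coe_exp, Complex.polarCoord_symm_apply]
          simp only [Complex.ofReal_cos, Complex.ofReal_sin, ← Complex.exp_mul_I]
          push_cast
          rw [add_mul, Complex.exp_add]
          ring
        rw [hz]
        by_cases hm : (r * Complex.exp ((θ + c : ℝ) * Complex.I) : ℂ) ∈ T
        · rw [Set.indicator_of_mem hm]
          have hn : ‖(r * Complex.exp ((θ + c : ℝ) * Complex.I) : ℂ)‖ = r := by
            rw [norm_mul, Complex.norm_exp_ofReal_mul_I, mul_one, Complex.norm_real,
              Real.norm_of_nonneg hr.le]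
          have ha : ((r * Complex.exp ((θ + c : ℝ) * Complex.I) : ℂ) *
              Complex.exp (-((c : ℝ) * Complex.I))).arg = θ := by
            rw [mul_assoc, ← Complex.exp_add, show (((θ + c : ℝ) : ℂ) * Complex.I +
              -((c : ℂ) * Complex.I)) = (θ : ℂ) * Complex.I by push_cast; ring,
              Complex.arg_real_mul _ hr, Complex.arg_exp_mul_I, (toIocMod_eq_self _).2]
            exact ⟨hθ.1, by linarith [hθ.2]⟩
          obtain ⟨h1, h2⟩ := hm
          rw [hn] at h1
          rw [ha] at h2
          rw [Set.indicator_of_mem h1,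
            Set.indicator_of_mem (s := Set.Icc _ _) (Set.mem_Icc.2 (abs_le.1 h2))]
          refine le_trans ?_ (hF r θ hr h1.1 h1.2 h2 (abs_lt.2 hθ))
          rw [smul_eq_mul]
          exact mul_le_of_le_one_left' (ENNReal.ofReal_le_one.2 h1.2.le)
        · rw [Set.indicator_of_notMem hm]
          simp
    _ ≤ ∫⁻ p : ℝ × ℝ, (Set.Ico (1 - h) 1).indicator A p.1 *
          (Set.Icc (-(Real.pi * h)) (Real.pi * h)).indicator B p.2 :=
        setLIntegral_le_lintegral _ _
    _ = (∫⁻ r in Set.Ico (1 - h) 1, A r) *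
        ∫⁻ θ in Set.Icc (-(Real.pi * h)) (Real.pi * h), B θ := by
        rw [Measure.volume_eq_prod, lintegral_prod_mul
          ((hA.indicator measurableSet_Ico).aemeasurable)
          ((hB.indicator measurableSet_Icc).aemeasurable),
          lintegral_indicator measurableSet_Ico, lintegral_indicator measurableSet_Icc]

lemma lintegral_Ioo_rpow {a L : ℝ} (ha : -1 < a) (hL : 0 ≤ L) :
    ∫⁻ x in Set.Ioo 0 L, ENNReal.ofReal (x ^ a) = ENNReal.ofReal (L ^ (a + 1) / (a + 1)) := by
  rw [← setLIntegral_congr (Ioo_ae_eq_Ioc (a := (0 : ℝ)) (b := L)).symm,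
    ← ofReal_integral_eq_lintegral_ofReal]
  · rw [← intervalIntegral.integral_of_le hL, integral_rpow (Or.inl ha), Real.zero_rpow (by linarith),
      sub_zero]
  · rw [← IntegrableOn, ← intervalIntegrable_iff_integrableOn_Ioc_of_le hL]
    exact intervalIntegral.intervalIntegrable_rpow' ha
  · exact (ae_restrict_mem measurableSet_Ioc).mono fun x hx => Real.rpow_nonneg hx.1.le _

lemma lintegral_Ico_one_sub_rpow {a h : ℝ} (ha : -1 < a) (hh : 0 ≤ h) :
    ∫⁻ r in Set.Ico (1 - h) 1, ENNReal.ofReal ((1 - r) ^ a) =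
      ENNReal.ofReal (h ^ (a + 1) / (a + 1)) := by
  rw [← lintegral_Ioo_rpow ha hh, ← setLIntegral_congr Ioo_ae_eq_Ico,
    ← lintegral_indicator measurableSet_Ioo, ← lintegral_indicator measurableSet_Ioo,
    ← lintegral_sub_left_eq_self _ (1 : ℝ)]
  congr 1
  ext x
  by_cases hx : x ∈ Set.Ioo 0 h
  · rw [Set.indicator_of_mem hx, Set.indicator_of_mem (by constructor <;> linarith [hx.1, hx.2])]
    congr 2
    ring
  · rw [Set.indicator_of_notMem hx, Set.indicator_of_notMem]
    exact fun h' => hx (by constructor <;> linarith [h'.1, h'.2])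

/-- The bound is uniform in the position `c` of the singularity. The power is taken in `ℝ≥0∞`, where
it is infinite, and not `0`, at `x = c`. -/
lemma lintegral_abs_sub_rpow_neg_le {e L : ℝ} (he0 : 0 ≤ e) (he : e < 1) (hL : 0 < L) (c : ℝ) :
    ∫⁻ x in Set.Icc (-L) L, ENNReal.ofReal |x - c| ^ (-e) ≤
      ENNReal.ofReal ((2 / (1 - e) + 2) * L ^ (1 - e)) := by
  have key : ∀ L : ℝ, 0 < L → ∫⁻ x in Set.Ioo 0 L, ENNReal.ofReal |x| ^ (-e) =
      ENNReal.ofReal (L ^ (1 - e) / (1 - e)) := by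
    intro L hL
    rw [show 1 - e = -e + 1 by ring, ← lintegral_Ioo_rpow (by linarith) hL.le]
    refine setLIntegral_congr_fun measurableSet_Ioo fun x hx => ?_
    rw [abs_of_pos hx.1, ENNReal.ofReal_rpow_of_pos hx.1]
  have key2 : ∫⁻ x in Set.Ioo (-L) 0, ENNReal.ofReal |x| ^ (-e) =
      ENNReal.ofReal (L ^ (1 - e) / (1 - e)) := by
    rw [← key L hL, ← lintegral_indicator measurableSet_Ioo, ← lintegral_indicator measurableSet_Ioo,
      ← lintegral_neg_eq_self]
    congr 1
    ext x
    by_cases hx : x ∈ Set.Ioo 0 L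
    · rw [Set.indicator_of_mem hx, Set.indicator_of_mem (by constructor <;> linarith [hx.1, hx.2]),
        abs_neg]
    · rw [Set.indicator_of_notMem hx, Set.indicator_of_notMem]
      exact fun h' => hx (by constructor <;> linarith [h'.1, h'.2])
  have near : ∫⁻ x in Set.Ioo (c - L) (c + L), ENNReal.ofReal |x - c| ^ (-e) ≤
      ENNReal.ofReal (2 / (1 - e) * L ^ (1 - e)) := by
    have : ∫⁻ x in Set.Ioo (c - L) (c + L), ENNReal.ofReal |x - c| ^ (-e) =
        ∫⁻ x in Set.Ioo (-L) L, ENNReal.ofReal |x| ^ (-e) := by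
      rw [← lintegral_indicator measurableSet_Ioo, ← lintegral_indicator measurableSet_Ioo,
        ← lintegral_sub_right_eq_self ((Set.Ioo (-L) L).indicator _) c]
      congr 1
      ext x
      by_cases hx : x ∈ Set.Ioo (c - L) (c + L)
      · rw [Set.indicator_of_mem hx,
          Set.indicator_of_mem (by constructor <;> linarith [hx.1, hx.2])]
      · rw [Set.indicator_of_notMem hx, Set.indicator_of_notMem]
        exact fun h' => hx (by constructor <;> linarith [h'.1, h'.2])
    rw [this]
    have hsub : Set.Ioo (-L) L ⊆ (Set.Ioo (-L) 0 ∪ Set.Ioo 0 L) ∪ {0} := by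
      intro x hx
      rcases lt_trichotomy x 0 with h | h | h
      · exact Or.inl (Or.inl ⟨hx.1, h⟩)
      · exact Or.inr h
      · exact Or.inl (Or.inr ⟨h, hx.2⟩)
    refine (lintegral_mono_set hsub).trans ?_
    refine (lintegral_union_le _ _ _).trans ?_
    rw [setLIntegral_measure_zero {(0 : ℝ)} _ (by simp), add_zero]
    refine (lintegral_union_le _ _ _).trans ?_
    have h1e : 0 < 1 - e := by linarith
    rw [key2, key L hL, ← ENNReal.ofReal_add (by positivity) (by positivity)]
    apply le_of_eq
    congr 1
    ring
  have far : ∫⁻ x in Set.Icc (-L) L \ Set.Ioo (c - L) (c + L), ENNReal.ofReal |x - c| ^ (-e) ≤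
      ENNReal.ofReal (2 * L ^ (1 - e)) := by
    calc _ ≤ ∫⁻ x in Set.Icc (-L) L \ Set.Ioo (c - L) (c + L), ENNReal.ofReal (L ^ (-e)) := by
          refine setLIntegral_mono' (measurableSet_Icc.diff measurableSet_Ioo) fun x hx => ?_
          have : L ≤ |x - c| := by
            by_contra! hlt
            rw [abs_lt] at hlt
            exact hx.2 ⟨by linarith [hlt.1], by linarith [hlt.2]⟩
          rw [ENNReal.ofReal_rpow_of_pos (by linarith)]
          exact ENNReal.ofReal_le_ofReal (Real.rpow_le_rpow_of_nonpos hL this (by linarith))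
      _ ≤ ∫⁻ x in Set.Icc (-L) L, ENNReal.ofReal (L ^ (-e)) := lintegral_mono_set Set.sdiff_subset
      _ = _ := by
          rw [setLIntegral_const, Real.volume_Icc, ← ENNReal.ofReal_mul (by positivity)]
          congr 1
          rw [show 1 - e = -e + 1 by ring, Real.rpow_add_one hL.ne']
          ring
  calc _ ≤ ∫⁻ x in Set.Ioo (c - L) (c + L) ∪ (Set.Icc (-L) L \ Set.Ioo (c - L) (c + L)),
            ENNReal.ofReal |x - c| ^ (-e) := by
        apply lintegral_mono_set
        rw [Set.union_sdiff_self]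
        exact Set.subset_union_right
    _ ≤ _ := (lintegral_union_le _ _ _).trans (add_le_add near far)
    _ = _ := by
        have : 0 < 1 - e := by linarith
        rw [← ENNReal.ofReal_add (by positivity) (by positivity)]
        congr 1
        ring

/-! ### The Volterra operator and area sub-mean values -/

lemma isOpen_disc : IsOpen disc := Metric.isOpen_ball

lemma mem_disc_iff {z : ℂ} : z ∈ disc ↔ ‖z‖ < 1 := by simp [disc]

lemma Holo.deriv {f : ℂ → ℂ} (hf : Holo f) : Holo (deriv f) :=
  DifferentiableOn.deriv hf isOpen_disc

lemma Holo.hasDerivAt {f : ℂ → ℂ} (hf : Holo f) {z : ℂ} (hz : z ∈ disc) :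
    HasDerivAt f (_root_.deriv f z) z :=
  (DifferentiableOn.differentiableAt hf (isOpen_disc.mem_nhds hz)).hasDerivAt

lemma ofReal_mul_mem_disc {z : ℂ} (hz : z ∈ disc) {t : ℝ} (ht : t ∈ Set.Icc (0 : ℝ) 1) :
    (t : ℂ) * z ∈ disc := by
  rw [mem_disc_iff] at *
  rw [norm_mul, Complex.norm_real, Real.norm_of_nonneg ht.1]
  exact (mul_le_of_le_one_left (norm_nonneg z) ht.2).trans_lt hz

lemma hasDerivAt_volterra {g f : ℂ → ℂ} (hg : Holo g) (hf : Holo f) {z : ℂ} (hz : z ∈ disc) :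
    HasDerivAt (volterra g f) (f z * deriv g z) z := by
  have hφ : Holo (fun w => f w * deriv g w) := DifferentiableOn.mul hf hg.deriv
  obtain ⟨F, hF⟩ := DifferentiableOn.isExactOn_ball hφ
  have key : ∀ w ∈ disc, volterra g f w = F w - F 0 := by
    intro w hw
    have hd : ∀ t ∈ Set.uIcc (0 : ℝ) 1, HasDerivAt (fun t : ℝ => F ((t : ℂ) * w))
        (f ((t : ℂ) * w) * deriv g ((t : ℂ) * w) * w) t := by
      intro t ht
      rw [Set.uIcc_of_le zero_le_one] at ht
      have h1 := hF _ (ofReal_mul_mem_disc hw ht)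
      have h2 : HasDerivAt (fun t : ℝ => (t : ℂ) * w) w t := by
        simpa using (Complex.ofRealCLM.hasDerivAt (x := t)).mul_const w
      exact HasDerivAt.comp t h1 h2
    have hc : ContinuousOn (fun t : ℝ => f ((t : ℂ) * w) * deriv g ((t : ℂ) * w) * w)
        (Set.uIcc (0 : ℝ) 1) := by
      rw [Set.uIcc_of_le zero_le_one]
      refine ContinuousOn.mul ?_ continuousOn_const
      refine (DifferentiableOn.continuousOn hφ).comp (f := fun t : ℝ => (t : ℂ) * w)
        (by fun_prop) fun t ht => ofReal_mul_mem_disc hw ht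
    rw [volterra, intervalIntegral.integral_eq_sub_of_hasDerivAt hd hc.intervalIntegrable]
    simp
  refine ((hF z hz).sub_const (F 0)).congr_of_eventuallyEq ?_
  filter_upwards [isOpen_disc.mem_nhds hz] with w hw using key w hw

lemma holo_volterra {g f : ℂ → ℂ} (hg : Holo g) (hf : Holo f) : Holo (volterra g f) :=
  fun _ hz => (hasDerivAt_volterra hg hf hz).differentiableAt.differentiableWithinAt

lemma blochNorm_volterra {g f : ℂ → ℂ} (hg : Holo g) (hf : Holo f) :
    blochNorm (volterra g f) =
      ⨆ z ∈ disc, ENNReal.ofReal ((1 - ‖z‖ ^ 2) * (‖f z‖ * ‖deriv g z‖)) := by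
  have h0 : volterra g f 0 = 0 := by simp [volterra]
  rw [blochNorm, h0, enorm_zero, zero_add, blochSeminorm]
  refine iSup_congr fun z => iSup_congr fun hz => ?_
  rw [(hasDerivAt_volterra hg hf hz).deriv, norm_mul]

lemma enorm_sq_le_circle_lintegral {u : ℂ → ℂ} {z : ℂ} {r ρ : ℝ} (hr : 0 < r) (hrρ : r < ρ)
    (hu : DifferentiableOn ℂ u (Metric.ball z ρ)) :
    ENNReal.ofReal (2 * Real.pi) * ‖u z‖ₑ ^ 2 ≤
      ∫⁻ θ in Set.Ioo (-Real.pi) Real.pi, ‖u (circleMap z r θ)‖ₑ ^ 2 := by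
  have hπ := Real.pi_pos
  have hd : DiffContOnCl ℂ (fun w => u w ^ 2) (Metric.ball z |r|) := by
    rw [abs_of_pos hr]
    refine DifferentiableOn.diffContOnCl ?_
    rw [closure_ball _ hr.ne']
    exact (hu.pow 2).mono (Metric.closedBall_subset_ball hrρ)
  have h := hd.circleAverage
  rw [Real.circleAverage_def] at h
  have hper : Function.Periodic (fun θ => u (circleMap z r θ) ^ 2) (2 * Real.pi) := by
    intro θ
    simp [periodic_circleMap z r θ]
  have h2 := hper.intervalIntegral_add_eq 0 (-Real.pi)
  rw [zero_add, show -Real.pi + 2 * Real.pi = Real.pi by ring] at h2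
  rw [h2, inv_smul_eq_iff₀ (by positivity)] at h
  calc ENNReal.ofReal (2 * Real.pi) * ‖u z‖ₑ ^ 2 = ‖(2 * Real.pi) • u z ^ 2‖ₑ := by
        rw [enorm_smul, enorm_pow, Real.enorm_eq_ofReal (by positivity)]
    _ = ‖∫ θ in Set.Ioc (-Real.pi) Real.pi, u (circleMap z r θ) ^ 2‖ₑ := by
        rw [← h, intervalIntegral.integral_of_le (by linarith)]
    _ ≤ ∫⁻ θ in Set.Ioc (-Real.pi) Real.pi, ‖u (circleMap z r θ) ^ 2‖ₑ :=
        enorm_integral_le_lintegral_enorm _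
    _ = _ := by
        rw [setLIntegral_congr Ioo_ae_eq_Ioc]
        simp only [enorm_pow]

/-- The area form of the sub-mean value property of `|u|²` for holomorphic `u`. -/
lemma enorm_sq_le_ball_lintegral {u : ℂ → ℂ} {z : ℂ} {ρ : ℝ} (hρ : 0 ≤ ρ) (hm : Measurable u)
    (hu : DifferentiableOn ℂ u (Metric.ball z ρ)) :
    ENNReal.ofReal (ρ ^ 2) * ‖u z‖ₑ ^ 2 ≤ ∫⁻ w in Metric.ball z ρ, ‖u w‖ₑ ^ 2 ∂area := by
  have hπ := Real.pi_pos
  set H : ℂ → ℝ≥0∞ := (Metric.ball z ρ).indicator fun w => ‖u w‖ₑ ^ 2 with hH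
  have hsq : ∫⁻ r in Set.Ioo 0 ρ, ENNReal.ofReal r = ENNReal.ofReal (ρ ^ 2 / 2) := by
    have := lintegral_Ioo_rpow (a := 1) (L := ρ) (by norm_num) hρ
    simp only [Real.rpow_one] at this
    rw [this]
    norm_num
  have main : ENNReal.ofReal (Real.pi * ρ ^ 2) * ‖u z‖ₑ ^ 2 ≤
      ∫⁻ w in Metric.ball z ρ, ‖u w‖ₑ ^ 2 := by
    calc ENNReal.ofReal (Real.pi * ρ ^ 2) * ‖u z‖ₑ ^ 2
        = ∫⁻ r in Set.Ioo 0 ρ, ENNReal.ofReal r *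
            (ENNReal.ofReal (2 * Real.pi) * ‖u z‖ₑ ^ 2) := by
          rw [lintegral_mul_const _ (by fun_prop), hsq, ← mul_assoc,
            ← ENNReal.ofReal_mul (by positivity)]
          congr 2
          ring
      _ ≤ ∫⁻ r in Set.Ioo 0 ρ, ENNReal.ofReal r *
            ∫⁻ θ in Set.Ioo (-Real.pi) Real.pi, ‖u (circleMap z r θ)‖ₑ ^ 2 :=
          setLIntegral_mono' measurableSet_Ioo fun r hr =>
            mul_le_mul_right (enorm_sq_le_circle_lintegral hr.1 hr.2 hu) _
      _ = ∫⁻ r in Set.Ioo 0 ρ, ∫⁻ θ in Set.Ioo (-Real.pi) Real.pi,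
            ENNReal.ofReal r * H (Complex.polarCoord.symm (r, θ) + z) := by
          refine setLIntegral_congr_fun measurableSet_Ioo fun r hr => ?_
          rw [← lintegral_const_mul' _ _ ENNReal.ofReal_ne_top]
          refine lintegral_congr fun θ => ?_
          have e : Complex.polarCoord.symm (r, θ) + z = circleMap z r θ := by
            rw [Complex.polarCoord_symm_apply]
            simp only [Complex.ofReal_cos, Complex.ofReal_sin, ← Complex.exp_mul_I, circleMap]
            ring
          have hmem : circleMap z r θ ∈ Metric.ball z ρ := by
            rw [Metric.mem_ball, dist_eq_norm, circleMap_sub_center, norm_circleMap_zero,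
              abs_of_pos hr.1]
            exact hr.2
          rw [e, hH, Set.indicator_of_mem hmem]
      _ ≤ ∫⁻ r in Set.Ioi 0, ∫⁻ θ in Set.Ioo (-Real.pi) Real.pi,
            ENNReal.ofReal r * H (Complex.polarCoord.symm (r, θ) + z) :=
          lintegral_mono_set fun r hr => hr.1
      _ = ∫⁻ p in polarCoord.target,
            ENNReal.ofReal p.1 • H (Complex.polarCoord.symm p + z) := by
          have hHm : Measurable H := Measurable.indicator (by fun_prop) Metric.isOpen_ball.measurableSet
          have hpm : Measurable fun p : ℝ × ℝ => Complex.polarCoord.symm p := by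
            simp only [Complex.polarCoord_symm_apply]
            fun_prop
          rw [show polarCoord.target = Set.Ioi (0 : ℝ) ×ˢ Set.Ioo (-Real.pi) Real.pi from rfl,
            Measure.volume_eq_prod, ← Measure.prod_restrict, lintegral_prod]
          · rfl
          · exact (Measurable.mul (by fun_prop) (by fun_prop)).aemeasurable
      _ = ∫⁻ w, H (w + z) := Complex.lintegral_comp_polarCoord_symm fun w => H (w + z)
      _ = ∫⁻ w, H w := lintegral_add_right_eq_self H z
      _ = _ := lintegral_indicator Metric.isOpen_ball.measurableSet _
  calc ENNReal.ofReal (ρ ^ 2) * ‖u z‖ₑ ^ 2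
      = ENNReal.ofReal (1 / Real.pi) * (ENNReal.ofReal (Real.pi * ρ ^ 2) * ‖u z‖ₑ ^ 2) := by
        rw [← mul_assoc, ← ENNReal.ofReal_mul (by positivity)]
        congr 2
        field_simp
    _ ≤ ENNReal.ofReal (1 / Real.pi) * ∫⁻ w in Metric.ball z ρ, ‖u w‖ₑ ^ 2 :=
        mul_le_mul_right main _
    _ = _ := by
        rw [area, Measure.restrict_smul, lintegral_smul_measure, smul_eq_mul]

/-- Every point `z` of the disc has a Carleson box, on an arc of length comparable to `1 - |z|`,
that contains the disc of radius `(1 - |z|) / 2` about `z`. -/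
lemma exists_ball_subset_carlesonBox {z : ℂ} (hz : z ∈ disc) :
    ∃ α h : ℝ, h ∈ Set.Ioc (0 : ℝ) 1 ∧ h ≤ 2 * (1 - ‖z‖) ∧
      Metric.ball z ((1 - ‖z‖) / 2) ⊆ carlesonBox α h := by
  have hπ := Real.pi_pos
  rw [mem_disc_iff] at hz
  have hdisc : ∀ w ∈ Metric.ball z ((1 - ‖z‖) / 2), w ∈ disc := by
    intro w hw
    rw [Metric.mem_ball, dist_eq_norm] at hw
    rw [mem_disc_iff]
    have := norm_sub_norm_le w z
    linarith
  -- Away from the boundary the whole disc serves as the box.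
  rcases le_or_gt (1 / 2) (1 - ‖z‖) with hδ | hδ
  · refine ⟨-Real.pi, 1, by norm_num, by linarith, fun w hw => ⟨hdisc w hw, by simp, ?_⟩⟩
    refine ⟨_, ⟨w.arg, ⟨(Complex.neg_pi_lt_arg w).le, ?_⟩, rfl⟩, ?_⟩
    · linarith [Complex.arg_le_pi w]
    · simp [circleMap, Complex.norm_mul_exp_arg_mul_I]
  · set δ := 1 - ‖z‖ with hδdef
    have hδ0 : 0 < δ := by linarith
    have hz0 : z ≠ 0 := norm_pos_iff.1 (by linarith)
    refine ⟨z.arg - Real.pi * (2 * δ), 2 * δ, ⟨by linarith, by linarith⟩, le_rfl,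
      fun w hw => ⟨hdisc w hw, ?_, ?_⟩⟩
    · rw [Metric.mem_ball, dist_comm, dist_eq_norm] at hw
      have := norm_sub_norm_le z w
      linarith
    rw [Metric.mem_ball, dist_eq_norm] at hw
    set v := w / z with hv
    have hwv : w = z * v := by rw [hv]; field_simp
    have hv1 : ‖v - 1‖ ≤ δ := by
      have : v - 1 = (w - z) / z := by rw [hv]; field_simp
      rw [this, norm_div, div_le_iff₀ (by linarith)]
      nlinarith
    have hre : 1 - δ ≤ v.re := by
      have := (abs_le.1 ((Complex.abs_re_le_norm (v - 1)).trans hv1)).1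
      simp at this
      linarith
    have him : |v.im| ≤ δ := by
      have := (Complex.abs_im_le_norm (v - 1)).trans hv1
      simpa using this
    have hvn : 1 / 2 ≤ ‖v‖ := by
      have := Complex.re_le_norm v
      linarith
    have harg : |v.arg| ≤ Real.pi * (2 * δ) := by
      have h1 : |v.arg| ≤ Real.pi / 2 := Complex.abs_arg_le_pi_div_two_iff.2 (by linarith)
      have h2 := Real.mul_abs_le_abs_sin h1
      rw [Complex.sin_arg, abs_div, abs_of_nonneg (norm_nonneg v)] at h2
      have h3 : |v.im| / ‖v‖ ≤ 2 * δ := by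
        rw [div_le_iff₀ (by linarith)]
        nlinarith
      have h4 : 2 / Real.pi * |v.arg| ≤ 2 * δ := h2.trans h3
      rw [div_mul_eq_mul_div, div_le_iff₀ hπ] at h4
      nlinarith
    refine ⟨_, ⟨z.arg + v.arg, ?_, rfl⟩, ?_⟩
    · rw [abs_le] at harg
      constructor <;> linarith [harg.1, harg.2]
    · have e : z * v = (‖z‖ * Complex.exp (z.arg * Complex.I)) *
          (‖v‖ * Complex.exp (v.arg * Complex.I)) := by
        rw [Complex.norm_mul_exp_arg_mul_I, Complex.norm_mul_exp_arg_mul_I]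
      rw [hwv, norm_mul, e]
      simp only [circleMap, Complex.ofReal_add, Complex.ofReal_mul, add_mul, Complex.exp_add]
      simp only [zero_add, Complex.ofReal_one, one_mul]
      ring

/-! ### Growth of the derivative -/

/-- The Bloch-type quantity `sup_{z ∈ 𝔻} (1-|z|)^b |f'(z)|`, through which both the box seminorms
and the operator norm of `T_g` are compared. -/
def derivGrowth (b : ℝ) (f : ℂ → ℂ) : ℝ≥0∞ :=
  ⨆ z ∈ disc, ENNReal.ofReal ((1 - ‖z‖) ^ b * ‖deriv f z‖)

lemma le_derivGrowth (b : ℝ) (f : ℂ → ℂ) {z : ℂ} (hz : z ∈ disc) :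
    ENNReal.ofReal ((1 - ‖z‖) ^ b * ‖deriv f z‖) ≤ derivGrowth b f :=
  le_iSup₂ (f := fun z (_ : z ∈ disc) => ENNReal.ofReal ((1 - ‖z‖) ^ b * ‖deriv f z‖)) z hz

lemma norm_deriv_le_of_derivGrowth_le {b K : ℝ} {f : ℂ → ℂ} (hK : 0 ≤ K)
    (h : derivGrowth b f ≤ ENNReal.ofReal K) {z : ℂ} (hz : z ∈ disc) :
    ‖deriv f z‖ ≤ K * (1 - ‖z‖) ^ (-b) := by
  have h1 := (ENNReal.ofReal_le_ofReal_iff hK).1 ((le_derivGrowth b f hz).trans h)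
  have h0 : 0 < 1 - ‖z‖ := by linarith [mem_disc_iff.1 hz]
  rw [Real.rpow_neg h0.le, ← div_eq_mul_inv, le_div_iff₀ (by positivity)]
  linarith

/-- Sub-mean values of `|f'|²` on discs inside Carleson boxes: the box seminorm with exponents
`s`, `q` controls the growth of `f'`. -/
lemma derivGrowth_le_boxSeminorm {s q : ℝ} (hs : 0 ≤ s) (hq : 0 ≤ q) {f : ℂ → ℂ} (hf : Holo f) :
    derivGrowth ((q + 2 - s) / 2) f ≤
      ENNReal.ofReal (2 ^ ((q + 2 + s) / 2)) * boxSeminorm s q f := by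
  refine iSup₂_le fun z hz => ?_
  set K := boxSeminorm s q f with hK
  obtain ⟨α, h, hh, hhle, hsub⟩ := exists_ball_subset_carlesonBox hz
  set δ := 1 - ‖z‖ with hδ
  have hδ0 : 0 < δ := by linarith [mem_disc_iff.1 hz]
  have hz1 := mem_disc_iff.1 hz
  set X := ∫⁻ w in carlesonBox α h,
        ENNReal.ofReal (‖deriv f w‖ ^ 2 * (1 - ‖w‖ ^ 2) ^ q) ∂area with hX
  have hXK : X ≤ K ^ 2 * ENNReal.ofReal ((2 * δ) ^ s) := by
    have h1 : (X / ENNReal.ofReal (h ^ s)) ^ (1 / 2 : ℝ) ≤ K :=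
      le_iSup_of_le α (le_iSup₂_of_le h hh le_rfl)
    have h2 : X / ENNReal.ofReal (h ^ s) ≤ K ^ 2 := by
      have := ENNReal.rpow_le_rpow h1 (z := 2) (by norm_num)
      rw [← ENNReal.rpow_mul] at this
      norm_num at this
      exact this
    have hh0 := hh.1
    have hpos : 0 < h ^ s := by positivity
    rw [ENNReal.div_le_iff (by simpa using hpos) ENNReal.ofReal_ne_top] at h2
    refine h2.trans (mul_le_mul_right (ENNReal.ofReal_le_ofReal ?_) _)
    exact Real.rpow_le_rpow hh0.le hhle hs
  have hXlow : ENNReal.ofReal ((δ / 2) ^ (q + 2)) * ‖deriv f z‖ₑ ^ 2 ≤ X := by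
    have hball : Metric.ball z (δ / 2) ⊆ disc := fun w hw => (hsub hw).1
    calc ENNReal.ofReal ((δ / 2) ^ (q + 2)) * ‖deriv f z‖ₑ ^ 2
        = ENNReal.ofReal ((δ / 2) ^ q) * (ENNReal.ofReal ((δ / 2) ^ 2) * ‖deriv f z‖ₑ ^ 2) := by
          rw [← mul_assoc, ← ENNReal.ofReal_mul (by positivity), Real.rpow_add (by positivity),
            Real.rpow_two]
      _ ≤ ENNReal.ofReal ((δ / 2) ^ q) * ∫⁻ w in Metric.ball z (δ / 2), ‖deriv f w‖ₑ ^ 2 ∂area :=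
          mul_le_mul_right (enorm_sq_le_ball_lintegral (by positivity) (measurable_deriv f)
            (DifferentiableOn.mono hf.deriv hball)) _
      _ = ∫⁻ w in Metric.ball z (δ / 2), ENNReal.ofReal ((δ / 2) ^ q) * ‖deriv f w‖ₑ ^ 2 ∂area :=
          (lintegral_const_mul' _ _ ENNReal.ofReal_ne_top).symm
      _ ≤ ∫⁻ w in Metric.ball z (δ / 2),
            ENNReal.ofReal (‖deriv f w‖ ^ 2 * (1 - ‖w‖ ^ 2) ^ q) ∂area := by
          refine setLIntegral_mono' Metric.isOpen_ball.measurableSet fun w hw => ?_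
          rw [← ofReal_norm, ← ENNReal.ofReal_pow (norm_nonneg _),
            ← ENNReal.ofReal_mul (by positivity), mul_comm]
          refine ENNReal.ofReal_le_ofReal (mul_le_mul_of_nonneg_left ?_ (by positivity))
          have hw1 := mem_disc_iff.1 (hball hw)
          rw [Metric.mem_ball, dist_eq_norm] at hw
          have := norm_sub_norm_le w z
          refine Real.rpow_le_rpow (by positivity) ?_ hq
          nlinarith [norm_nonneg w]
      _ ≤ X := lintegral_mono_set hsub
  have hmain := hXlow.trans hXK
  rw [← ENNReal.pow_le_pow_left_iff two_ne_zero, mul_pow, ← ENNReal.ofReal_pow (by positivity),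
    ← ENNReal.ofReal_pow (by positivity), mul_pow]
  calc ENNReal.ofReal ((δ ^ ((q + 2 - s) / 2)) ^ 2 * ‖deriv f z‖ ^ 2)
      = ENNReal.ofReal (2 ^ (q + 2) * δ ^ (-s)) *
          (ENNReal.ofReal ((δ / 2) ^ (q + 2)) * ‖deriv f z‖ₑ ^ 2) := by
        rw [← ofReal_norm, ← ENNReal.ofReal_pow (norm_nonneg _),
            ← ENNReal.ofReal_mul (by positivity), ← ENNReal.ofReal_mul (by positivity)]
        congr 1
        rw [← mul_assoc]
        congr 1
        rw [← Real.rpow_natCast, ← Real.rpow_mul hδ0.le, Real.div_rpow hδ0.le (by norm_num),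
          show ((q + 2 - s) / 2) * ((2 : ℕ) : ℝ) = -s + (q + 2) by push_cast; ring,
          Real.rpow_add hδ0]
        field_simp
    _ ≤ ENNReal.ofReal (2 ^ (q + 2) * δ ^ (-s)) * (K ^ 2 * ENNReal.ofReal ((2 * δ) ^ s)) :=
        mul_le_mul_right hmain _
    _ = _ := by
        rw [mul_comm (K ^ 2), ← mul_assoc, ← ENNReal.ofReal_mul (by positivity)]
        congr 2
        rw [← Real.rpow_natCast (2 ^ ((q + 2 + s) / 2)), ← Real.rpow_mul (by norm_num),
          show ((q + 2 + s) / 2) * ((2 : ℕ) : ℝ) = (q + 2) + s by push_cast; ring,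
          Real.rpow_add (by norm_num) (q + 2), Real.mul_rpow (by norm_num) hδ0.le,
          Real.rpow_neg hδ0.le]
        have : δ ^ s ≠ 0 := by positivity
        field_simp

lemma boxSeminorm_le {s q D : ℝ} {f : ℂ → ℂ} (hD : 0 ≤ D)
    (h : ∀ α : ℝ, ∀ h ∈ Set.Ioc (0 : ℝ) 1, ∫⁻ z in carlesonBox α h,
        ENNReal.ofReal (‖deriv f z‖ ^ 2 * (1 - ‖z‖ ^ 2) ^ q) ∂volume ≤
          ENNReal.ofReal (Real.pi * D ^ 2 * h ^ s)) :
    boxSeminorm s q f ≤ ENNReal.ofReal D := by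
  have hπ := Real.pi_pos
  refine iSup_le fun α => iSup₂_le fun t ht => ?_
  have ht0 := ht.1
  have hpos : 0 < t ^ s := by positivity
  have h1 : (∫⁻ z in carlesonBox α t,
        ENNReal.ofReal (‖deriv f z‖ ^ 2 * (1 - ‖z‖ ^ 2) ^ q) ∂area) / ENNReal.ofReal (t ^ s) ≤
        ENNReal.ofReal (D ^ 2) := by
    rw [ENNReal.div_le_iff (by simpa using hpos) ENNReal.ofReal_ne_top, area,
      Measure.restrict_smul, lintegral_smul_measure, smul_eq_mul]
    refine (mul_le_mul_right (h α t ht) _).trans ?_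
    rw [← ENNReal.ofReal_mul (by positivity), ← ENNReal.ofReal_mul (by positivity)]
    apply le_of_eq
    congr 1
    field_simp
  refine (ENNReal.rpow_le_rpow h1 (by norm_num)).trans ?_
  rw [ENNReal.ofReal_rpow_of_nonneg (by positivity) (by norm_num), ← Real.sqrt_eq_rpow,
    Real.sqrt_sq hD]

/-- Growth of `f'` of order `(1-|z|)^{-b}` bounds the box seminorm, because
`(1-|z|)^{q-2b}` has integral of order `h^{q-2b+2}` over a box on an arc of length `h`. -/
lemma boxSeminorm_le_derivGrowth {b q : ℝ} (hq : 0 ≤ q) (hb : -1 < q - 2 * b) (f : ℂ → ℂ) :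
    boxSeminorm (q - 2 * b + 2) q f ≤
      ENNReal.ofReal (√(2 * 2 ^ q / (q - 2 * b + 1))) * derivGrowth b f := by
  have hπ := Real.pi_pos
  have hden : 0 < q - 2 * b + 1 := by linarith
  rcases eq_or_ne (derivGrowth b f) ⊤ with htop | htop
  · rw [htop, ENNReal.mul_top]
    · exact le_top
    · rw [ne_eq, ENNReal.ofReal_eq_zero, not_le]
      positivity
  set n := (derivGrowth b f).toReal with hn
  have hn0 : 0 ≤ n := ENNReal.toReal_nonneg
  rw [← ENNReal.ofReal_toReal htop, ← hn, ← ENNReal.ofReal_mul (by positivity)]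
  refine boxSeminorm_le (by positivity) fun α h hh => ?_
  have hh0 := hh.1
  refine (lintegral_carlesonBox_le hh _
    (A := fun r => ENNReal.ofReal (n ^ 2 * 2 ^ q) * ENNReal.ofReal ((1 - r) ^ (q - 2 * b)))
    (B := fun _ => 1) (by fun_prop) (by fun_prop) ?_).trans ?_
  · intro r θ hr0 hr1 hr2 _ _
    rw [mul_one, ← ENNReal.ofReal_mul (by positivity)]
    apply ENNReal.ofReal_le_ofReal
    set z : ℂ := r * Complex.exp ((θ + (α + Real.pi * h) : ℝ) * Complex.I) with hz
    have hnorm : ‖z‖ = r := by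
      rw [hz, norm_mul, Complex.norm_exp_ofReal_mul_I, mul_one, Complex.norm_real,
        Real.norm_of_nonneg hr0.le]
    have hzd : z ∈ disc := mem_disc_iff.2 (by rw [hnorm]; exact hr2)
    have h1 := norm_deriv_le_of_derivGrowth_le (b := b) (f := f) hn0
      (by rw [hn, ENNReal.ofReal_toReal htop]) hzd
    rw [hnorm] at h1 ⊢
    have hr3 : 0 < 1 - r := by linarith
    calc ‖deriv f z‖ ^ 2 * (1 - r ^ 2) ^ q
        ≤ (n * (1 - r) ^ (-b)) ^ 2 * (2 * (1 - r)) ^ q := by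
          have h2 : 0 ≤ 1 - r ^ 2 := by nlinarith
          gcongr
          nlinarith
      _ = _ := by
          rw [mul_pow, Real.mul_rpow (by norm_num) hr3.le, ← Real.rpow_natCast ((1 - r) ^ (-b)),
            ← Real.rpow_mul hr3.le, show q - 2 * b = (-b) * ((2 : ℕ) : ℝ) + q by push_cast; ring,
            Real.rpow_add hr3]
          ring
  · rw [lintegral_const_mul' _ _ ENNReal.ofReal_ne_top, lintegral_Ico_one_sub_rpow hb hh0.le,
      setLIntegral_const, one_mul, Real.volume_Icc, ← ENNReal.ofReal_mul (by positivity),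
      ← ENNReal.ofReal_mul (by positivity)]
    apply le_of_eq
    congr 1
    rw [mul_pow, Real.sq_sqrt (by positivity), show q - 2 * b + 2 = (q - 2 * b + 1) + 1 by ring,
      Real.rpow_add_one hh0.ne' (q - 2 * b + 1)]
    field_simp
    ring

/-- Integration of the growth of `f'` along radii. -/
lemma norm_le_of_derivGrowth_le {γ K : ℝ} (hγ : 0 < γ) (hK : 0 ≤ K) {f : ℂ → ℂ} (hf : Holo f)
    (h : derivGrowth (γ + 1) f ≤ ENNReal.ofReal K) {z : ℂ} (hz : z ∈ disc) :
    ‖f z‖ ≤ ‖f 0‖ + K / γ * (1 - ‖z‖) ^ (-γ) := by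
  have hz1 := mem_disc_iff.1 hz
  have hpos : ∀ t ∈ Set.Icc (0 : ℝ) 1, 0 < 1 - t * ‖z‖ := by
    intro t ht
    nlinarith [ht.1, ht.2, norm_nonneg z]
  have hd : ∀ t ∈ Set.Icc (0 : ℝ) 1, HasDerivAt (fun t : ℝ => f ((t : ℂ) * z))
      (deriv f ((t : ℂ) * z) * z) t := by
    intro t ht
    have h1 := hf.hasDerivAt (ofReal_mul_mem_disc hz ht)
    have h2 : HasDerivAt (fun t : ℝ => (t : ℂ) * z) z t := by
      simpa using (Complex.ofRealCLM.hasDerivAt (x := t)).mul_const z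
    exact HasDerivAt.comp t h1 h2
  have hB : ∀ t ∈ Set.Icc (0 : ℝ) 1,
      HasDerivAt (fun t : ℝ => ‖f 0‖ + K / γ * (1 - t * ‖z‖) ^ (-γ))
        (K * (1 - t * ‖z‖) ^ (-(γ + 1)) * ‖z‖) t := by
    intro t ht
    have h1 : HasDerivAt (fun t : ℝ => 1 - t * ‖z‖) (-‖z‖) t := by
      simpa using ((hasDerivAt_id t).mul_const ‖z‖).const_sub 1
    have h2 := ((h1.rpow_const (p := -γ) (Or.inl (hpos t ht).ne')).const_mul (K / γ)).const_add ‖f 0‖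
    have e : K / γ * (-‖z‖ * -γ * (1 - t * ‖z‖) ^ (-γ - 1)) =
        K * (1 - t * ‖z‖) ^ (-(γ + 1)) * ‖z‖ := by
      rw [show -γ - 1 = -(γ + 1) by ring]
      field_simp
    rw [← e]
    exact h2
  have := image_norm_le_of_norm_deriv_right_le_deriv_boundary' (a := 0) (b := 1)
    (f := fun t : ℝ => f ((t : ℂ) * z)) (f' := fun t : ℝ => deriv f ((t : ℂ) * z) * z)
    (B := fun t : ℝ => ‖f 0‖ + K / γ * (1 - t * ‖z‖) ^ (-γ))
    (B' := fun t : ℝ => K * (1 - t * ‖z‖) ^ (-(γ + 1)) * ‖z‖)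
    (fun t ht => (hd t ht).continuousAt.continuousWithinAt)
    (fun t ht => (hd t (Set.Ico_subset_Icc_self ht)).hasDerivWithinAt)
    (by simp; positivity)
    (fun t ht => (hB t ht).continuousAt.continuousWithinAt)
    (fun t ht => (hB t (Set.Ico_subset_Icc_self ht)).hasDerivWithinAt)
    (by
      intro t ht
      have ht' := Set.Ico_subset_Icc_self ht
      rw [norm_mul]
      have h1 := norm_deriv_le_of_derivGrowth_le hK h (ofReal_mul_mem_disc hz ht')
      rw [norm_mul, Complex.norm_real, Real.norm_of_nonneg ht'.1] at h1
      gcongr)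
    (x := 1) (by simp)
  simpa using this

/-- A growth bound on `f` turns into a bound of `‖T_g f‖_B` because `(T_g f)' = f g'`. -/
lemma blochNorm_volterra_le {γ A : ℝ} (hA : 0 ≤ A) {g f : ℂ → ℂ} (hg : Holo g) (hf : Holo f)
    (h : ∀ z ∈ disc, ‖f z‖ ≤ A * (1 - ‖z‖) ^ (-γ)) :
    blochNorm (volterra g f) ≤ ENNReal.ofReal (2 * A) * derivGrowth (1 - γ) g := by
  rw [blochNorm_volterra hg hf]
  refine iSup₂_le fun z hz => ?_
  refine le_trans ?_ (mul_le_mul_right (le_derivGrowth (1 - γ) g hz) _)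
  rw [← ENNReal.ofReal_mul (by positivity)]
  apply ENNReal.ofReal_le_ofReal
  have hz1 := mem_disc_iff.1 hz
  have hδ : 0 < 1 - ‖z‖ := by linarith
  calc (1 - ‖z‖ ^ 2) * (‖f z‖ * ‖deriv g z‖)
      ≤ (2 * (1 - ‖z‖)) * ((A * (1 - ‖z‖) ^ (-γ)) * ‖deriv g z‖) := by
        gcongr
        · nlinarith [norm_nonneg z]
        · exact h z hz
    _ = _ := by
        rw [show 1 - γ = -γ + 1 by ring, Real.rpow_add_one hδ.ne']
        ring

/-! ### Test functions in the Morrey space -/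

lemma norm_one_sub_mul_exp_sq (x ψ : ℝ) :
    ‖1 - x * Complex.exp (ψ * Complex.I)‖ ^ 2 = (1 - x) ^ 2 + 4 * x * Real.sin (ψ / 2) ^ 2 := by
  have h : Real.cos ψ = 1 - 2 * Real.sin (ψ / 2) ^ 2 := by
    have := Real.cos_two_mul (ψ / 2)
    have h2 := Real.sin_sq_add_cos_sq (ψ / 2)
    rw [mul_div_cancel₀ _ two_ne_zero] at this
    linarith
  have h1 := Real.sin_sq_add_cos_sq ψ
  rw [← Complex.normSq_eq_norm_sq, Complex.normSq_apply]
  simp only [Complex.sub_re, Complex.one_re, Complex.sub_im, Complex.one_im, Complex.re_ofReal_mul,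
    Complex.im_ofReal_mul, Complex.exp_ofReal_mul_I_re, Complex.exp_ofReal_mul_I_im]
  linear_combination x ^ 2 * h1 - 2 * x * h

/-- In fact `|sin (ψ / 2)| ≤ |1 - x e^{iψ}|` for all `x` in the unit interval. -/
lemma abs_le_pi_mul_norm_one_sub {x ψ : ℝ} (hx : x ∈ Set.Icc (0 : ℝ) 1) (hψ : |ψ| ≤ Real.pi) :
    |ψ| ≤ Real.pi * ‖1 - x * Complex.exp (ψ * Complex.I)‖ := by
  have hπ := Real.pi_pos
  have h1 : |ψ / 2| ≤ Real.pi / 2 := by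
    rw [abs_div, abs_two]
    linarith
  have h2 := Real.mul_abs_le_abs_sin h1
  rw [abs_div, abs_two] at h2
  have h3 : |ψ| ≤ Real.pi * |Real.sin (ψ / 2)| := by
    have : 2 / Real.pi * (|ψ| / 2) = |ψ| / Real.pi := by ring
    rw [this, div_le_iff₀ hπ] at h2
    linarith
  refine h3.trans (mul_le_mul_of_nonneg_left ?_ hπ.le)
  refine abs_le_of_sq_le_sq ?_ (norm_nonneg _)
  rw [norm_one_sub_mul_exp_sq]
  have hs : Real.sin (ψ / 2) ^ 2 ≤ 1 := Real.sin_sq_le_one _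
  have hs0 := sq_nonneg (Real.sin (ψ / 2))
  rcases le_total (1 / 4) x with h | h
  · nlinarith [sq_nonneg (1 - x)]
  · nlinarith [mul_nonneg (show 0 ≤ 1 - 4 * x by linarith) (sub_nonneg.2 hs), hx.1, sq_nonneg x]

/-- A difference `ψ` of two arguments in `[-π, π]` lies within `π` of `0`, `2π` or `-2π`; the sum on
the right has one term for each case. -/
lemma rpow_neg_norm_one_sub_le {e x ψ : ℝ} (he : 0 ≤ e) (hx : x ∈ Set.Ico (0 : ℝ) 1)
    (hψ : |ψ| ≤ 2 * Real.pi) :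
    ENNReal.ofReal (‖1 - x * Complex.exp (ψ * Complex.I)‖ ^ (-e)) ≤
      ENNReal.ofReal (Real.pi ^ e) * (ENNReal.ofReal |ψ| ^ (-e) +
        ENNReal.ofReal |ψ - 2 * Real.pi| ^ (-e) + ENNReal.ofReal |ψ + 2 * Real.pi| ^ (-e)) := by
  have hπ := Real.pi_pos
  set a := ‖1 - x * Complex.exp (ψ * Complex.I)‖ with ha
  have ha0 : 0 < a := by
    rw [ha, norm_pos_iff, sub_ne_zero]
    intro h
    have := congrArg norm h
    rw [norm_mul, Complex.norm_exp_ofReal_mul_I, Complex.norm_real, Real.norm_of_nonneg hx.1] at this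
    simp at this
    linarith [hx.2]
  have key : ∀ y : ℝ, |y| ≤ Real.pi * a →
      ENNReal.ofReal (a ^ (-e)) ≤ ENNReal.ofReal (Real.pi ^ e) * ENNReal.ofReal |y| ^ (-e) := by
    intro y hy
    have h1 : ENNReal.ofReal (Real.pi * a) ^ (-e) ≤ ENNReal.ofReal |y| ^ (-e) := by
      rw [ENNReal.rpow_neg, ENNReal.rpow_neg, ENNReal.inv_le_inv]
      exact ENNReal.rpow_le_rpow (ENNReal.ofReal_le_ofReal hy) he
    refine le_trans (le_of_eq ?_) (mul_le_mul_right h1 _)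
    rw [ENNReal.ofReal_rpow_of_pos (by positivity), ← ENNReal.ofReal_mul (by positivity),
      Real.mul_rpow hπ.le ha0.le, ← mul_assoc, ← Real.rpow_add hπ]
    simp
  have hx' : x ∈ Set.Icc (0 : ℝ) 1 := ⟨hx.1, hx.2.le⟩
  have hshift : ∀ k : ℤ, |ψ - k * (2 * Real.pi)| ≤ Real.pi →
      |ψ - k * (2 * Real.pi)| ≤ Real.pi * a := by
    intro k hk
    have := abs_le_pi_mul_norm_one_sub hx' hk
    rwa [show (((ψ - k * (2 * Real.pi) : ℝ) : ℂ) * Complex.I) =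
      ψ * Complex.I - k * (2 * Real.pi * Complex.I) by push_cast; ring,
      Complex.exp_sub, Complex.exp_int_mul_two_pi_mul_I, div_one] at this
  rw [abs_le] at hψ
  rcases le_or_gt |ψ| Real.pi with h | h
  · refine (key ψ ?_).trans (mul_le_mul_right (by rw [add_assoc]; exact le_self_add) _)
    simpa using hshift 0 (by simpa using h)
  · rcases lt_abs.1 h with h | h
    · refine (key (ψ - 2 * Real.pi) ?_).trans (mul_le_mul_right ?_ _)
      · simpa using hshift 1 (by
          simp only [Int.cast_one, one_mul]
          rw [abs_le]; constructor <;> linarith [hψ.2])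
      · exact le_add_right le_add_self
    · refine (key (ψ + 2 * Real.pi) ?_).trans (mul_le_mul_right le_add_self _)
      simpa using hshift (-1) (by
        simp only [Int.cast_neg, Int.cast_one, neg_mul, one_mul, sub_neg_eq_add]
        rw [abs_le]; constructor <;> linarith [hψ.1])

/-- The box seminorm of order `lam` is bounded uniformly in `w ∈ 𝔻` for functions whose derivative
is dominated by `A |1 - w̄ z|^{-(3-lam)/2}`. In polar coordinates `|1 - w̄ z|` dominates both `1 - r`
and the distance of the arguments of `z` and `w`, so that `|1 - w̄ z|^{-(2-lam)}` splits into a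
product of two integrable powers. -/
lemma boxSeminorm_le_of_norm_deriv_le_kernel {lam : ℝ} (hlam0 : 0 < lam) (hlam1 : lam < 1) {A : ℝ}
    (hA : 0 ≤ A) {f : ℂ → ℂ} {w : ℂ} (hw : w ∈ disc)
    (hf : ∀ z ∈ disc, ‖deriv f z‖ ≤ A * ‖1 - (starRingEnd ℂ) w * z‖ ^ (-((3 - lam) / 2))) :
    boxSeminorm lam 1 f ≤ ENNReal.ofReal (A * √(12 / lam * (4 / lam + 2))) := by
  have hπ := Real.pi_pos
  refine boxSeminorm_le (by positivity) fun α h hh => ?_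
  have hh0 := hh.1
  set c := α + Real.pi * h with hc
  -- With `2 e = 2 - lam` and `e < 1`, both factors of the product bound are integrable.
  set e := 1 - lam / 2 with he
  have he0 : 0 ≤ e := by linarith
  set φ := (w * Complex.exp (-((c : ℝ) * Complex.I))).arg with hφ
  have hφπ : |φ| ≤ Real.pi := Complex.abs_arg_le_pi _
  have hweq : w = ‖w‖ * Complex.exp ((φ + c : ℝ) * Complex.I) := by
    have h1 := Complex.norm_mul_exp_arg_mul_I (w * Complex.exp (-((c : ℝ) * Complex.I)))
    rw [← hφ, norm_mul, ← neg_mul, ← Complex.ofReal_neg, Complex.norm_exp_ofReal_mul_I, mul_one] at h1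
    rw [Complex.ofReal_add, add_mul, Complex.exp_add, ← mul_assoc, h1, mul_assoc, ← Complex.exp_add]
    push_cast
    ring_nf
    simp
  set S : ℝ → ℝ≥0∞ := fun θ => ENNReal.ofReal |θ - φ| ^ (-e) +
        ENNReal.ofReal |θ - (φ + 2 * Real.pi)| ^ (-e) +
        ENNReal.ofReal |θ - (φ - 2 * Real.pi)| ^ (-e) with hS
  have hSm : ∀ y : ℝ, Measurable fun θ : ℝ => ENNReal.ofReal |θ - y| ^ (-e) := by
    intro y
    fun_prop
  have hSm' : Measurable S := ((hSm _).add (hSm _)).add (hSm _)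
  refine (lintegral_carlesonBox_le hh _
    (A := fun r => ENNReal.ofReal ((1 - r) ^ (-e)))
    (B := fun θ => ENNReal.ofReal (2 * A ^ 2 * Real.pi ^ e) * S θ)
    (by fun_prop) (hSm'.const_mul _) ?_).trans ?_
  · intro r θ hr0 hr1 hr2 hθ1 hθ2
    set z : ℂ := r * Complex.exp ((θ + (α + Real.pi * h) : ℝ) * Complex.I) with hz
    have hnorm : ‖z‖ = r := by
      rw [hz, norm_mul, Complex.norm_exp_ofReal_mul_I, mul_one, Complex.norm_real,
        Real.norm_of_nonneg hr0.le]
    have hzd : z ∈ disc := mem_disc_iff.2 (by rw [hnorm]; exact hr2)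
    have hw1 := mem_disc_iff.1 hw
    have hr3 : 0 < 1 - r := by linarith
    have hwz : (starRingEnd ℂ) w * z =
        ((‖w‖ * r : ℝ) : ℂ) * Complex.exp (((θ - φ : ℝ) : ℂ) * Complex.I) := by
      conv_lhs => rw [hweq]
      rw [map_mul, Complex.conj_ofReal, ← Complex.exp_conj, map_mul, Complex.conj_ofReal,
        Complex.conj_I, hz, mul_mul_mul_comm, ← Complex.exp_add, ← hc]
      push_cast
      ring_nf
    set a := ‖1 - (starRingEnd ℂ) w * z‖ with ha
    have hra : 1 - r ≤ a := by
      have h1 := norm_sub_norm_le (1 : ℂ) ((starRingEnd ℂ) w * z)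
      rw [norm_one, norm_mul, RCLike.norm_conj, hnorm] at h1
      nlinarith [norm_nonneg w]
    have ha0 : 0 < a := by linarith
    have h2 : ENNReal.ofReal (a ^ (-e)) ≤ ENNReal.ofReal (Real.pi ^ e) * S θ := by
      have h1 := rpow_neg_norm_one_sub_le (e := e) (x := ‖w‖ * r) (ψ := θ - φ) he0
        ⟨by positivity, by nlinarith [norm_nonneg w]⟩
        (by have := abs_sub θ φ; linarith)
      rw [← hwz, ← ha] at h1
      rw [hS]
      convert h1 using 6 <;> ring_nf
    have h3 : ‖deriv f z‖ ^ 2 * (1 - ‖z‖ ^ 2) ^ (1 : ℝ) ≤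
        2 * A ^ 2 * ((1 - r) ^ (-e) * a ^ (-e)) := by
      rw [Real.rpow_one, hnorm]
      have hd : 0 ≤ 1 - r ^ 2 := by nlinarith
      calc ‖deriv f z‖ ^ 2 * (1 - r ^ 2) ≤ (A * a ^ (-((3 - lam) / 2))) ^ 2 * (2 * a) := by
            gcongr
            · exact hf z hzd
            · nlinarith
        _ = 2 * A ^ 2 * (a ^ (-e) * a ^ (-e)) := by
            rw [mul_pow, ← Real.rpow_natCast (a ^ (-((3 - lam) / 2))), ← Real.rpow_mul ha0.le,
              ← Real.rpow_add ha0, show -e + -e = -((3 - lam) / 2) * ((2 : ℕ) : ℝ) + 1 by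
                rw [he]; push_cast; ring, Real.rpow_add_one ha0.ne']
            ring
        _ ≤ _ := by
            have := Real.rpow_le_rpow_of_nonpos hr3 hra (show -e ≤ 0 by linarith)
            gcongr
    refine (ENNReal.ofReal_le_ofReal h3).trans ?_
    rw [← mul_assoc, ENNReal.ofReal_mul (by positivity)]
    refine (mul_le_mul_right h2 _).trans (le_of_eq ?_)
    rw [ENNReal.ofReal_mul (p := 2 * A ^ 2) (by positivity),
      ENNReal.ofReal_mul (p := 2 * A ^ 2) (by positivity)]
    ring
  · have hint : ∫⁻ θ in Set.Icc (-(Real.pi * h)) (Real.pi * h), S θ ≤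
        ENNReal.ofReal (3 * ((2 / (1 - e) + 2) * (Real.pi * h) ^ (1 - e))) := by
      have h1 := fun y => lintegral_abs_sub_rpow_neg_le (e := e) (L := Real.pi * h) he0
        (by linarith) (by positivity) y
      simp only [hS]
      rw [lintegral_add_left (f := fun θ => ENNReal.ofReal |θ - φ| ^ (-e) +
        ENNReal.ofReal |θ - (φ + 2 * Real.pi)| ^ (-e)) ((hSm _).add (hSm _)),
        lintegral_add_left (hSm _)]
      refine (add_le_add (add_le_add (h1 _) (h1 _)) (h1 _)).trans (le_of_eq ?_)
      have : 0 ≤ (2 / (1 - e) + 2) * (Real.pi * h) ^ (1 - e) := by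
        have : 0 < 1 - e := by linarith
        positivity
      rw [← ENNReal.ofReal_add this this, ← ENNReal.ofReal_add (by positivity) this]
      congr 1
      ring
    rw [lintegral_Ico_one_sub_rpow (by linarith) hh0.le,
      lintegral_const_mul' _ _ ENNReal.ofReal_ne_top]
    refine (mul_le_mul_right (mul_le_mul_right hint _) _).trans ?_
    rw [← ENNReal.ofReal_mul (by positivity), ← ENNReal.ofReal_mul]
    swap
    · have : 0 < -e + 1 := by linarith
      positivity
    apply le_of_eq
    congr 1
    rw [mul_pow, Real.sq_sqrt (by positivity), show -e + 1 = lam / 2 by rw [he]; ring,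
      show 1 - e = lam / 2 by rw [he]; ring, Real.mul_rpow hπ.le hh0.le]
    have e1 : Real.pi ^ e * Real.pi ^ (lam / 2) = Real.pi := by
      rw [← Real.rpow_add hπ, he]
      simp
    have e2 : h ^ (lam / 2) * h ^ (lam / 2) = h ^ lam := by
      rw [← Real.rpow_add hh0]
      simp
    rw [← e2]
    nth_rewrite 3 [← e1]
    field_simp
    ring

/-- Lipschitz boundary values oscillate by `O(h)` on an arc of length `h`, so the squared oscillation
has integral `O(h³)`, which is more than the Morrey condition requires. -/
lemma memMorrey_of_norm_deriv_le {lam : ℝ} (hlam1 : lam < 1) {L : ℝ} {f : ℂ → ℂ}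
    (hd : ∀ z ∈ Metric.closedBall (0 : ℂ) 1, DifferentiableAt ℂ f z)
    (hL : ∀ z ∈ Metric.closedBall (0 : ℂ) 1, ‖deriv f z‖ ≤ L) : MemMorrey lam f := by
  have hπ := Real.pi_pos
  have hL0 : 0 ≤ L := (norm_nonneg _).trans (hL 0 (by simp))
  have hlip : ∀ z ∈ Metric.closedBall (0 : ℂ) 1, ∀ w ∈ Metric.closedBall (0 : ℂ) 1,
      ‖f w - f z‖ ≤ L * ‖w - z‖ := fun z hz w hw =>
    (convex_closedBall (0 : ℂ) 1).norm_image_sub_le_of_norm_deriv_le hd hL hz hw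
  have hcirc : ∀ r ∈ Set.Icc (0 : ℝ) 1, ∀ θ : ℝ, circleMap 0 r θ ∈ Metric.closedBall (0 : ℂ) 1 := by
    intro r hr θ
    rw [mem_closedBall_zero_iff, norm_circleMap_zero, abs_of_nonneg hr.1]
    exact hr.2
  have hbd : ∀ z ∈ Metric.closedBall (0 : ℂ) 1, ‖f z‖ₑ ≤ ENNReal.ofReal (‖f 0‖ + L) := by
    intro z hz
    rw [← ofReal_norm]
    apply ENNReal.ofReal_le_ofReal
    have h1 := hlip 0 (by simp) z hz
    have h2 := norm_sub_norm_le (f z) (f 0)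
    rw [sub_zero] at h1
    have h3 : ‖z‖ ≤ 1 := by simpa using hz
    nlinarith
  refine ⟨⟨fun z hz => (hd z (Metric.ball_subset_closedBall hz)).differentiableWithinAt, ?_⟩, f,
    ?_, ?_⟩
  · refine lt_of_le_of_lt (iSup₂_le (a := ENNReal.ofReal (1 / (2 * Real.pi)) *
      (ENNReal.ofReal (‖f 0‖ + L) ^ 2 * ENNReal.ofReal (2 * Real.pi))) fun r hr => ?_) ?_
    · refine mul_le_mul_right ?_ _
      calc _ ≤ ∫⁻ θ in Set.Ioc 0 (2 * Real.pi), ENNReal.ofReal (‖f 0‖ + L) ^ 2 :=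
            lintegral_mono fun θ => pow_le_pow_left' (hbd _ (hcirc r ⟨hr.1.le, hr.2.le⟩ θ)) 2
        _ = _ := by
            rw [setLIntegral_const, Real.volume_Ioc, sub_zero]
    · finiteness
  · refine Eventually.of_forall fun θ => ?_
    have h1 : ContinuousAt f (circleMap 0 1 θ) := (hd _ (hcirc 1 (by simp) θ)).continuousAt
    have h2 : Continuous fun r : ℝ => circleMap 0 r θ := by
      unfold circleMap
      fun_prop
    exact (h1.tendsto.comp h2.continuousAt.tendsto).mono_left nhdsWithin_le_nhds
  · have hcont : Continuous fun θ : ℝ => f (circleMap 0 1 θ) := by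
      rw [continuous_iff_continuousAt]
      intro θ
      exact ContinuousAt.comp (hd _ (hcirc 1 (by simp) θ)).continuousAt
        (continuous_circleMap 0 1).continuousAt
    refine lt_of_le_of_lt (iSup_le (a := ENNReal.ofReal (L * (2 * Real.pi))) fun α =>
      iSup₂_le fun h hh => ?_) ENNReal.ofReal_lt_top
    have hh0 := hh.1
    have hosc : ∀ θ ∈ Set.Icc α (α + 2 * Real.pi * h), ‖f (circleMap 0 1 θ) - arcMean f α h‖ ≤
        L * (2 * Real.pi * h) := by
      intro θ hθ
      have e : f (circleMap 0 1 θ) - arcMean f α h = ((1 / h * (1 / (2 * Real.pi)) : ℝ) : ℂ) *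
          ∫ t in Set.Icc α (α + 2 * Real.pi * h),
            (f (circleMap 0 1 θ) - f (circleMap 0 1 t)) := by
        rw [integral_sub (by simp) hcont.continuousOn.integrableOn_Icc, setIntegral_const,
          mul_sub, arcMean, Measure.real, Real.volume_Icc, add_sub_cancel_left,
          ENNReal.toReal_ofReal (by positivity), Complex.real_smul, ← mul_assoc,
          ← Complex.ofReal_mul]
        have : 1 / h * (1 / (2 * Real.pi)) * (2 * Real.pi * h) = 1 := by field_simp
        rw [this, Complex.ofReal_one, one_mul]
      rw [e, norm_mul, Complex.norm_real, Real.norm_of_nonneg (by positivity)]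
      have h1 : ‖∫ t in Set.Icc α (α + 2 * Real.pi * h),
            (f (circleMap 0 1 θ) - f (circleMap 0 1 t))‖ ≤
          L * (2 * Real.pi * h) * volume.real (Set.Icc α (α + 2 * Real.pi * h)) := by
        refine norm_setIntegral_le_of_norm_le_const (by simp) fun t ht => ?_
        refine (hlip _ (hcirc 1 (by simp) t) _ (hcirc 1 (by simp) θ)).trans ?_
        have h2 := (lipschitzWith_circleMap 0 1).dist_le_mul θ t
        rw [dist_eq_norm, Real.dist_eq] at h2
        simp at h2
        have h3 : |θ - t| ≤ 2 * Real.pi * h := by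
          rw [abs_le]
          constructor <;> linarith [hθ.1, hθ.2, ht.1, ht.2]
        gcongr
        exact h2.trans h3
      rw [Measure.real, Real.volume_Icc, add_sub_cancel_left,
          ENNReal.toReal_ofReal (by positivity)] at h1
      refine (mul_le_mul_of_nonneg_left h1 (by positivity)).trans (le_of_eq ?_)
      field_simp
    have h1 : ENNReal.ofReal (1 / (2 * Real.pi)) * ∫⁻ θ in Set.Icc α (α + 2 * Real.pi * h),
        ‖f (circleMap 0 1 θ) - arcMean f α h‖ₑ ^ 2 ≤
        ENNReal.ofReal ((L * (2 * Real.pi)) ^ 2 * h ^ 3) := by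
      calc _ ≤ ENNReal.ofReal (1 / (2 * Real.pi)) * ∫⁻ θ in Set.Icc α (α + 2 * Real.pi * h),
            ENNReal.ofReal ((L * (2 * Real.pi * h)) ^ 2) := by
            refine mul_le_mul_right (setLIntegral_mono' measurableSet_Icc fun θ hθ => ?_) _
            rw [← ofReal_norm, ← ENNReal.ofReal_pow (norm_nonneg _)]
            exact ENNReal.ofReal_le_ofReal (pow_le_pow_left₀ (norm_nonneg _) (hosc θ hθ) 2)
        _ = _ := by
            rw [setLIntegral_const, Real.volume_Icc, add_sub_cancel_left,
              ← ENNReal.ofReal_mul (by positivity), ← ENNReal.ofReal_mul (by positivity)]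
            congr 1
            field_simp
    have hpos : 0 < h ^ lam := by positivity
    have h2 : (ENNReal.ofReal (1 / (2 * Real.pi)) * ∫⁻ θ in Set.Icc α (α + 2 * Real.pi * h),
        ‖f (circleMap 0 1 θ) - arcMean f α h‖ₑ ^ 2) / ENNReal.ofReal (h ^ lam) ≤
        ENNReal.ofReal ((L * (2 * Real.pi)) ^ 2) := by
      rw [ENNReal.div_le_iff (by simpa using hpos) ENNReal.ofReal_ne_top]
      refine h1.trans ?_
      rw [← ENNReal.ofReal_mul (by positivity)]
      apply ENNReal.ofReal_le_ofReal
      gcongr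
      rw [← Real.rpow_natCast]
      exact Real.rpow_le_rpow_of_exponent_ge hh0 hh.2 (by push_cast; linarith)
    refine (ENNReal.rpow_le_rpow h2 (by norm_num)).trans ?_
    rw [ENNReal.ofReal_rpow_of_nonneg (by positivity) (by norm_num), ← Real.sqrt_eq_rpow,
      Real.sqrt_sq (by positivity)]

/-- The test function `c (1 - w̄ z)^{-γ}`, which has extremal growth at the point `w`. -/
def testFun (γ c : ℝ) (w z : ℂ) : ℂ := c * (1 - (starRingEnd ℂ) w * z) ^ (-γ : ℂ)

lemma one_sub_norm_le_norm_one_sub_conj_mul {w z : ℂ} (hz : ‖z‖ ≤ 1) :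
    1 - ‖w‖ ≤ ‖1 - (starRingEnd ℂ) w * z‖ := by
  have h1 := norm_sub_norm_le (1 : ℂ) ((starRingEnd ℂ) w * z)
  rw [norm_one, norm_mul, RCLike.norm_conj] at h1
  nlinarith [norm_nonneg w]

lemma norm_testFun {γ c : ℝ} (hc : 0 ≤ c) {w z : ℂ} (hw : w ∈ disc) (hz : ‖z‖ ≤ 1) :
    ‖testFun γ c w z‖ = c * ‖1 - (starRingEnd ℂ) w * z‖ ^ (-γ) := by
  have h1 := one_sub_norm_le_norm_one_sub_conj_mul (w := w) hz
  have h2 := mem_disc_iff.1 hw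
  have h0 : 1 - (starRingEnd ℂ) w * z ≠ 0 := norm_pos_iff.1 (by linarith)
  rw [testFun, norm_mul, Complex.norm_real, Real.norm_of_nonneg hc, ← Complex.ofReal_neg,
    Complex.norm_cpow_of_ne_zero h0]
  simp

lemma hasDerivAt_testFun (γ c : ℝ) {w z : ℂ} (hw : w ∈ disc) (hz : ‖z‖ ≤ 1) :
    HasDerivAt (testFun γ c w)
      (γ * (starRingEnd ℂ) w * testFun (γ + 1) c w z) z := by
  have hre : 0 < (1 - (starRingEnd ℂ) w * z).re := by
    have h1 := Complex.re_le_norm ((starRingEnd ℂ) w * z)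
    rw [norm_mul, RCLike.norm_conj] at h1
    have h2 := mem_disc_iff.1 hw
    rw [Complex.sub_re, Complex.one_re]
    nlinarith [norm_nonneg w]
  have h1 : HasDerivAt (fun z : ℂ => 1 - (starRingEnd ℂ) w * z) (-(starRingEnd ℂ) w) z := by
    simpa using ((hasDerivAt_id z).const_mul ((starRingEnd ℂ) w)).const_sub 1
  have h2 := (h1.cpow_const (c := (-γ : ℂ)) (Or.inl hre)).const_mul (c : ℂ)
  have e : (c : ℂ) * (-(γ : ℂ) * (1 - (starRingEnd ℂ) w * z) ^ (-(γ : ℂ) - 1) *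
      -(starRingEnd ℂ) w) = γ * (starRingEnd ℂ) w * testFun (γ + 1) c w z := by
    rw [testFun, show -(((γ + 1 : ℝ)) : ℂ) = -(γ : ℂ) - 1 by push_cast; ring]
    ring
  rw [← e]
  exact h2

lemma norm_deriv_testFun_le {γ c : ℝ} (hγ0 : 0 ≤ γ) (hγ1 : γ ≤ 1) (hc : 0 ≤ c) {w z : ℂ}
    (hw : w ∈ disc) (hz : ‖z‖ ≤ 1) :
    ‖deriv (testFun γ c w) z‖ ≤ c * ‖1 - (starRingEnd ℂ) w * z‖ ^ (-(γ + 1)) := by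
  rw [(hasDerivAt_testFun γ c hw hz).deriv, norm_mul, norm_testFun hc hw hz, norm_mul,
    RCLike.norm_conj, Complex.norm_real, Real.norm_of_nonneg hγ0]
  have h2 := mem_disc_iff.1 hw
  refine mul_le_of_le_one_left (by positivity) ?_
  nlinarith [norm_nonneg w]

lemma memMorrey_testFun {lam γ c : ℝ} (hlam1 : lam < 1) (hγ0 : 0 ≤ γ) (hγ1 : γ ≤ 1) (hc : 0 ≤ c)
    {w : ℂ} (hw : w ∈ disc) : MemMorrey lam (testFun γ c w) := by
  have h2 := mem_disc_iff.1 hw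
  refine memMorrey_of_norm_deriv_le hlam1 (L := c * (1 - ‖w‖) ^ (-(γ + 1)))
    (fun z hz => (hasDerivAt_testFun γ c hw (by simpa using hz)).differentiableAt) fun z hz => ?_
  have hz : ‖z‖ ≤ 1 := by simpa using hz
  refine (norm_deriv_testFun_le hγ0 hγ1 hc hw hz).trans ?_
  exact mul_le_mul_of_nonneg_left (Real.rpow_le_rpow_of_nonpos (by linarith)
    (one_sub_norm_le_norm_one_sub_conj_mul hz) (by linarith)) hc

/-- Testing `T_g` on the functions `testFun` with `γ = (1-lam)/2`, which have extremal growth. -/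
lemma derivGrowth_le_volterraNorm {lam : ℝ} (hlam0 : 0 < lam) (hlam1 : lam < 1) {g : ℂ → ℂ}
    (hg : Holo g) :
    derivGrowth ((1 + lam) / 2) g ≤
      ENNReal.ofReal (2 * (1 + √(12 / lam * (4 / lam + 2)))) * volterraNorm lam g := by
  set D := √(12 / lam * (4 / lam + 2)) with hD
  have hD0 : 0 ≤ D := Real.sqrt_nonneg _
  -- The factor `c` normalizes the test functions: `|f(0)| = c` and the box seminorm is at most `c D`.
  set c : ℝ := 1 / (1 + D) with hc
  have hc0 : 0 < c := by positivity
  set γ := (1 - lam) / 2 with hγ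
  have hγ0 : 0 ≤ γ := by linarith
  have hγ1 : γ ≤ 1 := by linarith
  refine iSup₂_le fun w hw => ?_
  have hw1 := mem_disc_iff.1 hw
  have hmem := memMorrey_testFun (lam := lam) hlam1 hγ0 hγ1 hc0.le hw
  have hnorm : morreyNorm lam (testFun γ c w) ≤ 1 := by
    have h1 : boxSeminorm lam 1 (testFun γ c w) ≤ ENNReal.ofReal (c * D) := by
      refine boxSeminorm_le_of_norm_deriv_le_kernel hlam0 hlam1 hc0.le hw fun z hz => ?_
      have := norm_deriv_testFun_le hγ0 hγ1 hc0.le hw (mem_disc_iff.1 hz).le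
      rwa [show (3 - lam) / 2 = γ + 1 by rw [hγ]; ring]
    have h0 : ‖testFun γ c w 0‖ₑ = ENNReal.ofReal c := by
      rw [← ofReal_norm, norm_testFun hc0.le hw (by simp)]
      simp
    rw [morreyNorm, h0]
    refine (add_le_add_right h1 _).trans (le_of_eq ?_)
    rw [← ENNReal.ofReal_add hc0.le (by positivity), ← ENNReal.ofReal_one]
    congr 1
    rw [hc]
    field_simp
  have hT : blochNorm (volterra g (testFun γ c w)) ≤ volterraNorm lam g :=
    le_iSup_of_le _ (le_iSup₂_of_le hmem hnorm le_rfl)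
  rw [blochNorm_volterra hg hmem.1.1] at hT
  refine le_trans ?_ (mul_le_mul_right ((le_iSup₂ (f := fun z (_ : z ∈ disc) => ENNReal.ofReal
    ((1 - ‖z‖ ^ 2) * (‖testFun γ c w z‖ * ‖deriv g z‖))) w hw).trans hT) _)
  rw [← ENNReal.ofReal_mul (by positivity)]
  apply ENNReal.ofReal_le_ofReal
  have e : ‖1 - (starRingEnd ℂ) w * w‖ = 1 - ‖w‖ ^ 2 := by
    rw [mul_comm, Complex.mul_conj, Complex.normSq_eq_norm_sq, ← Complex.ofReal_one,
      ← Complex.ofReal_sub, Complex.norm_real, Real.norm_of_nonneg]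
    nlinarith [norm_nonneg w]
  have hδ : 0 < 1 - ‖w‖ := by linarith
  have hδ2 : 1 - ‖w‖ ≤ 1 - ‖w‖ ^ 2 := by nlinarith [norm_nonneg w]
  have hδ3 : 0 < 1 - ‖w‖ ^ 2 := by linarith
  rw [norm_testFun hc0.le hw hw1.le, e, ← mul_assoc, ← mul_assoc]
  refine mul_le_mul_of_nonneg_right ?_ (norm_nonneg _)
  have e3 : (1 - ‖w‖ ^ 2) ^ ((1 + lam) / 2) = (1 - ‖w‖ ^ 2) * (1 - ‖w‖ ^ 2) ^ (-γ) := by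
    rw [show (1 + lam) / 2 = -γ + 1 by rw [hγ]; ring, Real.rpow_add_one hδ3.ne']
    ring
  have e4 : (1 - ‖w‖) ^ ((1 + lam) / 2) ≤ (1 - ‖w‖ ^ 2) * (1 - ‖w‖ ^ 2) ^ (-γ) := by
    rw [← e3]
    exact Real.rpow_le_rpow hδ.le hδ2 (by linarith)
  have e5 : 2 * (1 + D) * ((1 - ‖w‖ ^ 2) * (c * (1 - ‖w‖ ^ 2) ^ (-γ))) =
      2 * ((1 - ‖w‖ ^ 2) * (1 - ‖w‖ ^ 2) ^ (-γ)) := by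
    rw [hc]
    field_simp
  have e6 : 0 ≤ (1 - ‖w‖ ^ 2) * (1 - ‖w‖ ^ 2) ^ (-γ) := by positivity
  linarith

/-! ### Morrey conditions on the circle -/

lemma setLIntegral_Ioc_of_periodic {p : ℝ → ℝ≥0∞} (hp : Function.Periodic p (2 * Real.pi)) (a : ℝ) :
    ∫⁻ θ in Set.Ioc a (a + 2 * Real.pi), p θ = ∫⁻ θ in Set.Ioc 0 (2 * Real.pi), p θ := by
  have h := (isAddFundamentalDomain_Ioc Real.two_pi_pos a).setLIntegral_eq
    (isAddFundamentalDomain_Ioc Real.two_pi_pos 0) p fun g => hp.map_vadd_zmultiples g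
  rwa [zero_add] at h

/-- A bound in `L²` prevents escape of mass: `v ≤ min v A + v² / A`, where the first term is handled
by dominated convergence and the integral of the second is small for large `A`. -/
lemma tendsto_lintegral_zero_of_lintegral_sq_le {X : Type*} [MeasurableSpace X] {μ : Measure X}
    [IsFiniteMeasure μ] {v : ℕ → X → ℝ≥0∞} (hm : ∀ n, AEMeasurable (v n) μ) {M : ℝ≥0∞}
    (hMtop : M ≠ ∞) (hM : ∀ n, ∫⁻ x, v n x ^ 2 ∂μ ≤ M)
    (hv : ∀ᵐ x ∂μ, Tendsto (fun n => v n x) atTop (𝓝 0)) :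
    Tendsto (fun n => ∫⁻ x, v n x ∂μ) atTop (𝓝 0) := by
  rw [ENNReal.tendsto_nhds_zero]
  intro ε hε
  rcases eq_or_ne ε ∞ with rfl | hεtop
  · exact Eventually.of_forall fun n => le_top
  have hε2 : 0 < ε / 2 := ENNReal.half_pos hε.ne'
  have hε2top : ε / 2 ≠ ∞ := ENNReal.div_ne_top hεtop two_ne_zero
  set A : ℝ≥0∞ := M / (ε / 2) + 1 with hA
  have hAtop : A ≠ ∞ := by
    rw [hA]
    exact ENNReal.add_ne_top.2 ⟨ENNReal.div_ne_top hMtop hε2.ne', ENNReal.one_ne_top⟩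
  have hA0 : A ≠ 0 := by simp [hA]
  have htail : M / A ≤ ε / 2 := by
    rw [ENNReal.div_le_iff hA0 hAtop, hA, mul_add]
    exact le_trans (le_of_eq (ENNReal.mul_div_cancel hε2.ne' hε2top).symm) le_self_add
  have hmin : Tendsto (fun n => ∫⁻ x, min (v n x) A ∂μ) atTop (𝓝 0) := by
    have := tendsto_lintegral_of_dominated_convergence' (μ := μ) (f := fun _ => 0) (fun _ => A)
      (fun n => (hm n).min aemeasurable_const)
      (fun n => Eventually.of_forall fun x => min_le_right _ _)
      (by rw [lintegral_const]; exact ENNReal.mul_ne_top hAtop (measure_ne_top _ _))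
      (by
        filter_upwards [hv] with x hx
        simpa using hx.min (tendsto_const_nhds (x := A)))
    simpa using this
  filter_upwards [ENNReal.tendsto_nhds_zero.1 hmin (ε / 2) hε2] with n hn
  calc ∫⁻ x, v n x ∂μ ≤ ∫⁻ x, (min (v n x) A + v n x ^ 2 / A) ∂μ := by
        refine lintegral_mono fun x => ?_
        rcases le_total (v n x) A with h | h
        · rw [min_eq_left h]
          exact le_self_add
        · refine le_add_left ?_
          rw [ENNReal.le_div_iff_mul_le (Or.inl hA0) (Or.inl hAtop), sq]
          gcongr
    _ = ∫⁻ x, min (v n x) A ∂μ + (∫⁻ x, v n x ^ 2 ∂μ) / A := by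
        rw [lintegral_add_left' ((hm n).min aemeasurable_const)]
        simp only [div_eq_mul_inv]
        rw [lintegral_mul_const' _ _ (ENNReal.inv_ne_top.2 hA0)]
    _ ≤ ε / 2 + ε / 2 := add_le_add hn ((ENNReal.div_le_div_right (hM n) A).trans htail)
    _ = ε := ENNReal.add_halves ε

/-- An `L²` oscillation bound of order `h^lam` gives an `L¹` oscillation bound of order
`h^((1+lam)/2)`. -/
lemma exists_lintegral_sub_arcMean_le {lam : ℝ} {F : ℂ → ℂ}
    (hF : (⨆ (α : ℝ) (h ∈ Set.Ioc (0 : ℝ) 1), arcOscillation lam F α h) < ∞) :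
    ∃ D : ℝ, 0 ≤ D ∧ ∀ α : ℝ, ∀ h ∈ Set.Ioc (0 : ℝ) 1,
      ∫⁻ θ in Set.Icc α (α + 2 * Real.pi * h), ‖F (circleMap 0 1 θ) - arcMean F α h‖ₑ ≤
        ENNReal.ofReal (D * h ^ ((1 + lam) / 2)) := by
  have hπ := Real.pi_pos
  set S := ⨆ (α : ℝ) (h ∈ Set.Ioc (0 : ℝ) 1), arcOscillation lam F α h with hS
  set K := S.toReal with hK
  refine ⟨2 * Real.pi * (K ^ 2 + 1), by positivity, fun α h hh => ?_⟩
  have hh0 := hh.1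
  set G := fun θ : ℝ => ‖F (circleMap 0 1 θ) - arcMean F α h‖ₑ with hG
  have h1 : arcOscillation lam F α h ≤ S := le_iSup_of_le α (le_iSup₂_of_le h hh le_rfl)
  have hpos : 0 < h ^ lam := by positivity
  have h2 : ∫⁻ θ in Set.Icc α (α + 2 * Real.pi * h), G θ ^ 2 ≤
      ENNReal.ofReal (2 * Real.pi * K ^ 2 * h ^ lam) := by
    have h3 := ENNReal.rpow_le_rpow h1 (z := 2) (by norm_num)
    rw [arcOscillation, ← ENNReal.rpow_mul] at h3
    norm_num at h3
    rw [ENNReal.div_le_iff (by simpa using hpos) ENNReal.ofReal_ne_top,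
      ← ENNReal.ofReal_toReal hF.ne, ← hK, ← ENNReal.ofReal_pow ENNReal.toReal_nonneg,
      ← ENNReal.ofReal_mul (by positivity)] at h3
    calc _ = ENNReal.ofReal (2 * Real.pi) * (ENNReal.ofReal (Real.pi⁻¹ * (1 / 2)) *
          ∫⁻ θ in Set.Icc α (α + 2 * Real.pi * h), G θ ^ 2) := by
          rw [← mul_assoc, ← ENNReal.ofReal_mul (by positivity)]
          rw [show 2 * Real.pi * (Real.pi⁻¹ * (1 / 2)) = 1 by field_simp]
          simp
      _ ≤ _ := mul_le_mul_right h3 _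
      _ = _ := by
          rw [← ENNReal.ofReal_mul (by positivity)]
          congr 1
          ring
  -- The weight `t` balances the two terms of `x ≤ x² / t + t`.
  set t : ℝ := h ^ ((lam - 1) / 2) with ht
  have ht0 : 0 < t := by positivity
  have htE : ENNReal.ofReal t ≠ 0 := by simpa using ht0
  calc ∫⁻ θ in Set.Icc α (α + 2 * Real.pi * h), G θ
      ≤ ∫⁻ θ in Set.Icc α (α + 2 * Real.pi * h), (G θ ^ 2 / ENNReal.ofReal t + ENNReal.ofReal t) := by
        refine lintegral_mono fun θ => ?_
        rcases le_total (G θ) (ENNReal.ofReal t) with h | h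
        · exact le_add_left h
        · refine le_add_right ?_
          rw [ENNReal.le_div_iff_mul_le (Or.inl htE) (Or.inl ENNReal.ofReal_ne_top), sq]
          gcongr
    _ = (∫⁻ θ in Set.Icc α (α + 2 * Real.pi * h), G θ ^ 2) / ENNReal.ofReal t +
          ENNReal.ofReal t * ENNReal.ofReal (2 * Real.pi * h) := by
        rw [lintegral_add_right _ measurable_const, setLIntegral_const, Real.volume_Icc,
          add_sub_cancel_left]
        simp only [div_eq_mul_inv]
        rw [lintegral_mul_const' _ _ (ENNReal.inv_ne_top.2 htE)]
    _ ≤ ENNReal.ofReal (2 * Real.pi * K ^ 2 * h ^ lam) / ENNReal.ofReal t +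
          ENNReal.ofReal t * ENNReal.ofReal (2 * Real.pi * h) := by
        gcongr
    _ = _ := by
        rw [← ENNReal.ofReal_div_of_pos ht0, ← ENNReal.ofReal_mul ht0.le,
          ← ENNReal.ofReal_add (by positivity) (by positivity)]
        congr 1
        have e1 : h ^ lam = t * h ^ ((1 + lam) / 2) := by
          rw [ht, ← Real.rpow_add hh0]
          congr 1
          ring
        have e2 : t * h = h ^ ((1 + lam) / 2) := by
          rw [ht, ← Real.rpow_add_one hh0.ne']
          congr 1
          ring
        rw [e1]
        field_simp
        rw [← e2]
        ring

/-- Comparing an arc with its double: since `(1+lam)/2 < 1`, the means grow slowly enough for the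
`L¹` oscillation bound to pass to the `L¹` norm. -/
lemma exists_lintegral_arc_le {κ D A : ℝ} (hκ1 : κ < 1) (hD : 0 ≤ D)
    (hA0 : 0 ≤ A) {F : ℂ → ℂ}
    (hosc : ∀ α : ℝ, ∀ h ∈ Set.Ioc (0 : ℝ) 1,
      ∫⁻ θ in Set.Icc α (α + 2 * Real.pi * h), ‖F (circleMap 0 1 θ) - arcMean F α h‖ₑ ≤
        ENNReal.ofReal (D * h ^ κ))
    (hA : ∀ α : ℝ, ∫⁻ θ in Set.Icc α (α + 2 * Real.pi), ‖F (circleMap 0 1 θ)‖ₑ ≤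
      ENNReal.ofReal A) (hκ0 : 0 ≤ κ) :
    ∃ C : ℝ, 0 ≤ C ∧ ∀ α : ℝ, ∀ h ∈ Set.Ioc (0 : ℝ) 1,
      ∫⁻ θ in Set.Icc α (α + 2 * Real.pi * h), ‖F (circleMap 0 1 θ)‖ₑ ≤
        ENNReal.ofReal (C * h ^ κ) := by
  have hπ := Real.pi_pos
  have hq : 0 < 1 - (2 : ℝ) ^ κ / 2 := by
    have : (2 : ℝ) ^ κ < 2 ^ (1 : ℝ) := Real.rpow_lt_rpow_of_exponent_lt (by norm_num) hκ1
    rw [Real.rpow_one] at this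
    linarith
  have h2κ : (0 : ℝ) < 2 ^ κ := by positivity
  -- `C` solves `2^κ D + (2^κ / 2) C ≤ C`, which closes the recursion, and handles `h > 1/2`.
  set C : ℝ := A * 2 ^ κ + 2 ^ κ * D / (1 - 2 ^ κ / 2) with hC
  have hC0 : 0 ≤ C := by positivity
  have hC1 : A * 2 ^ κ ≤ C := le_add_of_nonneg_right (by positivity)
  have hC2 : 2 ^ κ * D + 2 ^ κ / 2 * C ≤ C := by
    have : 2 ^ κ * D / (1 - 2 ^ κ / 2) ≤ C := le_add_of_nonneg_left (by positivity)
    rw [div_le_iff₀ hq] at this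
    linarith
  refine ⟨C, hC0, fun α h hh => ?_⟩
  have key : ∀ n : ℕ, ∀ h : ℝ, (1 / 2) ^ n < h → h ≤ 1 →
      ∫⁻ θ in Set.Icc α (α + 2 * Real.pi * h), ‖F (circleMap 0 1 θ)‖ₑ ≤
        ENNReal.ofReal (C * h ^ κ) := by
    intro n
    induction n with
    | zero =>
      intro h h1 h2
      simp only [pow_zero] at h1
      linarith
    | succ n ih =>
      intro h h1 h2
      have hh0 : 0 < h := lt_trans (by positivity) h1
      rcases lt_or_ge (1 / 2) h with h3 | h3
      · refine ((lintegral_mono_set (Set.Icc_subset_Icc_right (by nlinarith))).trans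
          (hA α)).trans (ENNReal.ofReal_le_ofReal ?_)
        have h4 : 1 ≤ 2 ^ κ * h ^ κ := by
          rw [← Real.mul_rpow (by norm_num) hh0.le]
          exact Real.one_le_rpow (by linarith) hκ0
        calc A ≤ A * (2 ^ κ * h ^ κ) := le_mul_of_one_le_right hA0 h4
          _ = A * 2 ^ κ * h ^ κ := by ring
          _ ≤ C * h ^ κ := by gcongr
      · have hd : 2 * h ∈ Set.Ioc (0 : ℝ) 1 := ⟨by linarith, by linarith⟩
        have ih' := ih (2 * h) (by rw [pow_succ] at h1; linarith) hd.2
        set m := arcMean F α (2 * h) with hm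
        have hmean : ‖m‖ₑ * ENNReal.ofReal (2 * Real.pi * h) ≤
            ENNReal.ofReal (1 / 2 * (C * (2 * h) ^ κ)) := by
          have h5 : ‖m‖ₑ ≤ ENNReal.ofReal (1 / (2 * h) * (1 / (2 * Real.pi))) *
              ENNReal.ofReal (C * (2 * h) ^ κ) := by
            rw [hm, arcMean, enorm_mul]
            refine mul_le_mul' (le_of_eq ?_) ((enorm_integral_le_lintegral_enorm _).trans ih')
            rw [← ofReal_norm, Complex.norm_real, Real.norm_of_nonneg (by positivity)]
          refine (mul_le_mul_left h5 _).trans (le_of_eq ?_)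
          rw [← ENNReal.ofReal_mul (by positivity), ← ENNReal.ofReal_mul (by positivity)]
          congr 1
          field_simp
        calc ∫⁻ θ in Set.Icc α (α + 2 * Real.pi * h), ‖F (circleMap 0 1 θ)‖ₑ
            ≤ ∫⁻ θ in Set.Icc α (α + 2 * Real.pi * h), (‖F (circleMap 0 1 θ) - m‖ₑ + ‖m‖ₑ) := by
              refine lintegral_mono fun θ => ?_
              have := enorm_add_le (F (circleMap 0 1 θ) - m) m
              rwa [sub_add_cancel] at this
          _ = (∫⁻ θ in Set.Icc α (α + 2 * Real.pi * h), ‖F (circleMap 0 1 θ) - m‖ₑ) +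
                ‖m‖ₑ * ENNReal.ofReal (2 * Real.pi * h) := by
              rw [lintegral_add_right _ measurable_const, setLIntegral_const, Real.volume_Icc,
                add_sub_cancel_left]
          _ ≤ ENNReal.ofReal (D * (2 * h) ^ κ) + ENNReal.ofReal (1 / 2 * (C * (2 * h) ^ κ)) := by
              refine add_le_add ((lintegral_mono_set (Set.Icc_subset_Icc_right ?_)).trans
                (hosc α _ hd)) hmean
              nlinarith
          _ ≤ _ := by
              rw [← ENNReal.ofReal_add (by positivity) (by positivity)]
              apply ENNReal.ofReal_le_ofReal
              rw [Real.mul_rpow (by norm_num) hh0.le]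
              calc _ = (2 ^ κ * D + 2 ^ κ / 2 * C) * h ^ κ := by ring
                _ ≤ _ := by gcongr
  obtain ⟨n, hn⟩ := exists_pow_lt_of_lt_one hh.1 (show (1 / 2 : ℝ) < 1 by norm_num)
  exact key n h hn hh.2

/-- If the integral of `u` over `[φ - s, φ + s]` is `O(s^κ)` with `κ < 1`, then the integral
of `u` against `1 / max(δ, |θ-φ|)` is `O(δ^{κ-1})`, by `1 / x = ∫_x^∞ s^{-2} ds` and Tonelli. -/
lemma lintegral_mul_inv_max_le {κ C δ φ : ℝ} (hκ1 : κ < 1) (hC : 0 ≤ C) (hδ : 0 < δ)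
    {s : Set ℝ} {u : ℝ → ℝ≥0∞} (hu : AEMeasurable u (volume.restrict s))
    (h : ∀ t : ℝ, 0 < t → ∫⁻ θ in s, (Metric.ball φ t).indicator u θ ≤ ENNReal.ofReal (C * t ^ κ)) :
    ∫⁻ θ in s, u θ * ENNReal.ofReal (1 / max δ |θ - φ|) ≤
      ENNReal.ofReal (C * δ ^ (κ - 1) / (1 - κ)) := by
  have hinv : ∀ a : ℝ, a < -1 → ∀ x : ℝ, 0 < x →
      ∫⁻ t in Set.Ioi x, ENNReal.ofReal (t ^ a) = ENNReal.ofReal (-x ^ (a + 1) / (a + 1)) := by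
    intro a ha x hx
    rw [← integral_Ioi_rpow_of_lt ha hx, ofReal_integral_eq_lintegral_ofReal]
    · exact integrableOn_Ioi_rpow_of_lt ha hx
    · exact (ae_restrict_mem measurableSet_Ioi).mono fun t ht =>
        Real.rpow_nonneg (hx.trans ht).le _
  have hmeas : AEMeasurable (Function.uncurry fun θ t : ℝ => ENNReal.ofReal (t ^ (-2 : ℝ)) *
      (Metric.ball φ t).indicator u θ) ((volume.restrict s).prod (volume.restrict (Set.Ioi δ))) := by
    have hset : MeasurableSet {p : ℝ × ℝ | dist p.1 φ < p.2} :=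
      measurableSet_lt (by fun_prop) (by fun_prop)
    have h1 : AEMeasurable (fun p : ℝ × ℝ => u p.1)
        ((volume.restrict s).prod (volume.restrict (Set.Ioi δ))) :=
      hu.comp_quasiMeasurePreserving Measure.quasiMeasurePreserving_fst
    have h2 := h1.indicator hset
    have h3 : AEMeasurable (fun p : ℝ × ℝ => ENNReal.ofReal (p.2 ^ (-2 : ℝ)))
        ((volume.restrict s).prod (volume.restrict (Set.Ioi δ))) := by fun_prop
    exact h3.mul h2
  calc ∫⁻ θ in s, u θ * ENNReal.ofReal (1 / max δ |θ - φ|)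
      = ∫⁻ θ in s, ∫⁻ t in Set.Ioi δ, ENNReal.ofReal (t ^ (-2 : ℝ)) *
          (Metric.ball φ t).indicator u θ := by
        refine lintegral_congr fun θ => ?_
        have hmax : 0 < max δ |θ - φ| := lt_max_of_lt_left hδ
        have e1 : ENNReal.ofReal (1 / max δ |θ - φ|) =
            ∫⁻ t in Set.Ioi (max δ |θ - φ|), ENNReal.ofReal (t ^ (-2 : ℝ)) := by
          rw [hinv _ (by norm_num) _ hmax]
          congr 1
          norm_num [Real.rpow_neg_one]
        rw [e1, ← lintegral_const_mul _ (by fun_prop), ← lintegral_indicator measurableSet_Ioi,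
          ← lintegral_indicator measurableSet_Ioi]
        refine lintegral_congr fun t => ?_
        have hball : θ ∈ Metric.ball φ t ↔ |θ - φ| < t := Iff.rfl
        simp only [Set.indicator_apply, Set.mem_Ioi, max_lt_iff]
        by_cases h1 : δ < t <;> by_cases h2 : |θ - φ| < t <;> simp [h1, h2, hball, mul_comm]
    _ = ∫⁻ t in Set.Ioi δ, ∫⁻ θ in s, ENNReal.ofReal (t ^ (-2 : ℝ)) *
          (Metric.ball φ t).indicator u θ := lintegral_lintegral_swap hmeas
    _ ≤ ∫⁻ t in Set.Ioi δ, ENNReal.ofReal C * ENNReal.ofReal (t ^ (κ - 2)) := by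
        refine setLIntegral_mono' measurableSet_Ioi fun t ht => ?_
        have ht0 : 0 < t := hδ.trans ht
        rw [lintegral_const_mul' _ _ ENNReal.ofReal_ne_top]
        refine (mul_le_mul_right (h t ht0) _).trans (le_of_eq ?_)
        rw [← ENNReal.ofReal_mul (by positivity), ← ENNReal.ofReal_mul hC]
        congr 1
        rw [show κ - 2 = κ + (-2) by ring, Real.rpow_add ht0]
        ring
    _ = _ := by
        rw [lintegral_const_mul' _ _ ENNReal.ofReal_ne_top, hinv _ (by linarith) _ hδ,
          ← ENNReal.ofReal_mul hC]
        congr 1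
        rw [show κ - 2 + 1 = κ - 1 by ring, show (1 : ℝ) - κ = -(κ - 1) by ring, div_neg, neg_div]
        ring

/-! ### Growth of functions in the Morrey space -/

/-- Cauchy's formula for the dilation `f (r ·)`, as an inequality. -/
lemma enorm_le_cauchy_lintegral {f : ℂ → ℂ} (hf : Holo f) {r : ℝ} (hr : r ∈ Set.Ioo (0 : ℝ) 1)
    {z : ℂ} (hz : z ∈ disc) (α : ℝ) :
    ENNReal.ofReal (2 * Real.pi) * ‖f (r * z)‖ₑ ≤
      ∫⁻ θ in Set.Ioc α (α + 2 * Real.pi),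
        ‖f (circleMap 0 r θ)‖ₑ * ENNReal.ofReal (1 / ‖circleMap 0 1 θ - z‖) := by
  have hπ := Real.pi_pos
  have hr0 := hr.1
  have hd : DiffContOnCl ℂ f (Metric.ball 0 |r|) := by
    rw [abs_of_pos hr0]
    refine DifferentiableOn.diffContOnCl ?_
    rw [closure_ball _ hr0.ne']
    exact DifferentiableOn.mono hf (Metric.closedBall_subset_ball hr.2)
  have hw : (r : ℂ) * z ∈ Metric.ball (0 : ℂ) |r| := by
    rw [mem_ball_zero_iff, norm_mul, Complex.norm_real, Real.norm_eq_abs]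
    have := mem_disc_iff.1 hz
    have := abs_pos.2 hr0.ne'
    nlinarith
  have h := hd.circleAverage_smul_div hw
  rw [Real.circleAverage_def, inv_smul_eq_iff₀ (by positivity)] at h
  set p : ℝ → ℂ := fun θ => ((circleMap 0 r θ - 0) / (circleMap 0 r θ - r * z)) •
    f (circleMap 0 r θ) with hp
  have hper : Function.Periodic (fun θ => ‖p θ‖ₑ) (2 * Real.pi) := by
    intro θ
    simp only [hp, periodic_circleMap 0 r θ]
  calc ENNReal.ofReal (2 * Real.pi) * ‖f (r * z)‖ₑ = ‖(2 * Real.pi) • f (r * z)‖ₑ := by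
        rw [enorm_smul, Real.enorm_eq_ofReal (by positivity)]
    _ = ‖∫ θ in Set.Ioc 0 (2 * Real.pi), p θ‖ₑ := by
        rw [← h, intervalIntegral.integral_of_le (by positivity)]
    _ ≤ ∫⁻ θ in Set.Ioc 0 (2 * Real.pi), ‖p θ‖ₑ := enorm_integral_le_lintegral_enorm _
    _ = ∫⁻ θ in Set.Ioc α (α + 2 * Real.pi), ‖p θ‖ₑ := (setLIntegral_Ioc_of_periodic hper α).symm
    _ = _ := by
        refine lintegral_congr fun θ => ?_
        rw [hp, enorm_smul, mul_comm, ← ofReal_norm ((circleMap 0 r θ - 0) / _), norm_div]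
        congr 2
        have e : circleMap 0 r θ = r * circleMap 0 1 θ := by simp [circleMap]
        rw [sub_zero, norm_circleMap_zero, abs_of_pos hr0, e, ← mul_sub, norm_mul,
          Complex.norm_real, Real.norm_of_nonneg hr0.le]
        rcases eq_or_ne ‖circleMap 0 1 θ - z‖ 0 with h0 | h0
        · rw [h0]
          simp
        · field_simp

lemma max_le_pi_mul_norm_circleMap_sub {z : ℂ} (hz : z ∈ disc) {θ : ℝ}
    (hθ : |θ - z.arg| ≤ Real.pi) :
    max (1 - ‖z‖) |θ - z.arg| ≤ Real.pi * ‖circleMap 0 1 θ - z‖ := by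
  have hz1 := mem_disc_iff.1 hz
  have e : ‖circleMap 0 1 θ - z‖ =
      ‖1 - ‖z‖ * Complex.exp (((z.arg - θ : ℝ) : ℂ) * Complex.I)‖ := by
    have h1 : circleMap 0 1 θ - z = Complex.exp (θ * Complex.I) *
        (1 - ‖z‖ * Complex.exp (((z.arg - θ : ℝ) : ℂ) * Complex.I)) := by
      have h2 : Complex.exp (θ * Complex.I) *
          (‖z‖ * Complex.exp (((z.arg - θ : ℝ) : ℂ) * Complex.I)) = z := by
        rw [mul_left_comm, ← Complex.exp_add, show (θ : ℂ) * Complex.I +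
          ((z.arg - θ : ℝ) : ℂ) * Complex.I = z.arg * Complex.I by push_cast; ring,
          Complex.norm_mul_exp_arg_mul_I]
      rw [mul_sub, h2]
      simp [circleMap]
    rw [h1, norm_mul, Complex.norm_exp_ofReal_mul_I, one_mul]
  refine max_le ?_ ?_
  · have h1 := norm_sub_norm_le (circleMap 0 1 θ) z
    rw [norm_circleMap_zero, abs_one] at h1
    nlinarith [Real.pi_gt_three, norm_nonneg (circleMap 0 1 θ - z)]
  · rw [e, abs_sub_comm]
    exact abs_le_pi_mul_norm_one_sub ⟨norm_nonneg z, hz1.le⟩ (by rwa [abs_sub_comm])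

/-- By Fatou's lemma the `L²` bound of the dilations passes to the boundary function. Hence it is
integrable over the circle, and the dilations converge to it in `L¹`. -/
lemma exists_boundary_bounds {f F : ℂ → ℂ} (hf : MemHardyTwo f) (hF : IsBoundaryFunction f F) :
    ∃ r : ℕ → ℝ, (∀ n, r n ∈ Set.Ioo (0 : ℝ) 1) ∧ Tendsto r atTop (𝓝 1) ∧
      AEStronglyMeasurable (fun θ : ℝ => F (circleMap 0 1 θ)) volume ∧
      (∃ A : ℝ, 0 ≤ A ∧ ∀ α : ℝ, ∫⁻ θ in Set.Icc α (α + 2 * Real.pi), ‖F (circleMap 0 1 θ)‖ₑ ≤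
        ENNReal.ofReal A) ∧
      ∀ α : ℝ, Tendsto (fun n => ∫⁻ θ in Set.Ioc α (α + 2 * Real.pi),
        ‖f (circleMap 0 (r n) θ) - F (circleMap 0 1 θ)‖ₑ) atTop (𝓝 0) := by
  have hπ := Real.pi_pos
  obtain ⟨hholo, hsup⟩ := hf
  set H := ⨆ r ∈ Set.Ioo (0 : ℝ) 1, ENNReal.ofReal (1 / (2 * Real.pi)) *
      ∫⁻ θ in Set.Ioc 0 (2 * Real.pi), ‖f (circleMap 0 r θ)‖ₑ ^ 2 with hH
  set M := ENNReal.ofReal (2 * Real.pi) * H with hM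
  have hMtop : M ≠ ∞ := ENNReal.mul_ne_top ENNReal.ofReal_ne_top hsup.ne
  set r : ℕ → ℝ := fun n => 1 - 1 / ((n : ℝ) + 2) with hr
  have hrmem : ∀ n, r n ∈ Set.Ioo (0 : ℝ) 1 := by
    intro n
    have h1 : (0 : ℝ) < (n : ℝ) + 2 := by positivity
    constructor
    · rw [hr, sub_pos, div_lt_one h1]
      linarith [(Nat.cast_nonneg n : (0 : ℝ) ≤ n)]
    · rw [hr, sub_lt_self_iff]
      positivity
  have hrlim : Tendsto r atTop (𝓝 1) := by
    have h1 : Tendsto (fun n : ℕ => 1 / ((n : ℝ) + 2)) atTop (𝓝 0) :=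
      Tendsto.div_atTop tendsto_const_nhds
        (tendsto_atTop_add_const_right _ _ tendsto_natCast_atTop_atTop)
    have h2 := h1.const_sub (1 : ℝ)
    rwa [sub_zero] at h2
  have hrlim' : Tendsto r atTop (𝓝[<] 1) :=
    tendsto_nhdsWithin_iff.2 ⟨hrlim, Eventually.of_forall fun n => (hrmem n).2⟩
  set u : ℕ → ℝ → ℂ := fun n θ => f (circleMap 0 (r n) θ) with hu
  set G : ℝ → ℂ := fun θ => F (circleMap 0 1 θ) with hG
  have hucont : ∀ n, Continuous (u n) := by
    intro n
    refine (DifferentiableOn.continuousOn hholo).comp_continuous (continuous_circleMap 0 (r n)) ?_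
    intro θ
    rw [mem_disc_iff, norm_circleMap_zero, abs_of_pos (hrmem n).1]
    exact (hrmem n).2
  have hlim : ∀ᵐ θ : ℝ, Tendsto (fun n => u n θ) atTop (𝓝 (G θ)) := by
    filter_upwards [hF] with θ hθ using hθ.comp hrlim'
  have hGm : AEStronglyMeasurable G volume :=
    aestronglyMeasurable_of_tendsto_ae atTop (fun n => (hucont n).aestronglyMeasurable) hlim
  have huM : ∀ α : ℝ, ∀ n, ∫⁻ θ in Set.Ioc α (α + 2 * Real.pi), ‖u n θ‖ₑ ^ 2 ≤ M := by
    intro α n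
    have hper : Function.Periodic (fun θ => ‖u n θ‖ₑ ^ 2) (2 * Real.pi) := by
      intro θ
      simp only [hu, periodic_circleMap 0 (r n) θ]
    rw [setLIntegral_Ioc_of_periodic hper]
    have h1 : ENNReal.ofReal (1 / (2 * Real.pi)) *
      ∫⁻ θ in Set.Ioc 0 (2 * Real.pi), ‖u n θ‖ₑ ^ 2 ≤ H :=
      le_iSup₂ (f := fun r (_ : r ∈ Set.Ioo (0 : ℝ) 1) => ENNReal.ofReal (1 / (2 * Real.pi)) *
        ∫⁻ θ in Set.Ioc 0 (2 * Real.pi), ‖f (circleMap 0 r θ)‖ₑ ^ 2) (r n) (hrmem n)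
    have h2 := mul_le_mul_right h1 (ENNReal.ofReal (2 * Real.pi))
    rwa [← mul_assoc, ← ENNReal.ofReal_mul (by positivity),
      show 2 * Real.pi * (1 / (2 * Real.pi)) = 1 by field_simp, ENNReal.ofReal_one, one_mul] at h2
  have hGM : ∀ α : ℝ, ∫⁻ θ in Set.Ioc α (α + 2 * Real.pi), ‖G θ‖ₑ ^ 2 ≤ M := by
    intro α
    calc ∫⁻ θ in Set.Ioc α (α + 2 * Real.pi), ‖G θ‖ₑ ^ 2
        = ∫⁻ θ in Set.Ioc α (α + 2 * Real.pi), liminf (fun n => ‖u n θ‖ₑ ^ 2) atTop := by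
          refine lintegral_congr_ae ?_
          filter_upwards [ae_restrict_of_ae hlim] with θ hθ
          exact (((ENNReal.continuous_pow 2).tendsto _).comp hθ.enorm).liminf_eq.symm
      _ ≤ liminf (fun n => ∫⁻ θ in Set.Ioc α (α + 2 * Real.pi), ‖u n θ‖ₑ ^ 2) atTop :=
          lintegral_liminf_le fun n => ((hucont n).enorm.measurable.pow_const 2)
      _ ≤ M := liminf_le_of_frequently_le' (Frequently.of_forall fun n => huM α n)
  refine ⟨r, hrmem, hrlim, hGm, ⟨(M + ENNReal.ofReal (2 * Real.pi)).toReal, ENNReal.toReal_nonneg,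
    fun α => ?_⟩, fun α => ?_⟩
  · rw [ENNReal.ofReal_toReal (by finiteness), setLIntegral_congr Ioc_ae_eq_Icc.symm]
    calc ∫⁻ θ in Set.Ioc α (α + 2 * Real.pi), ‖G θ‖ₑ
        ≤ ∫⁻ θ in Set.Ioc α (α + 2 * Real.pi), (‖G θ‖ₑ ^ 2 + 1) := by
          refine lintegral_mono fun θ => ?_
          rcases le_total ‖G θ‖ₑ 1 with h | h
          · exact le_add_left h
          · exact le_add_right (le_self_pow h two_ne_zero)
      _ ≤ _ := by
          rw [lintegral_add_right _ measurable_const, setLIntegral_const, Real.volume_Ioc,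
            add_sub_cancel_left, one_mul]
          gcongr
          exact hGM α
  · refine tendsto_lintegral_zero_of_lintegral_sq_le (M := 4 * (M + M))
      (fun n => ((hucont n).aestronglyMeasurable.sub hGm).enorm.restrict) (by finiteness)
      (fun n => ?_) ?_
    · calc _ ≤ ∫⁻ θ in Set.Ioc α (α + 2 * Real.pi), 4 * (‖u n θ‖ₑ ^ 2 + ‖G θ‖ₑ ^ 2) := by
            refine lintegral_mono fun θ => ?_
            refine (pow_le_pow_left' (enorm_sub_le (a := u n θ) (b := G θ)) 2).trans ?_
            have key : ∀ a b : ℝ≥0∞, a ≤ b → (a + b) ^ 2 ≤ 4 * (a ^ 2 + b ^ 2) := by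
              intro a b hab
              calc (a + b) ^ 2 ≤ (b + b) ^ 2 := by gcongr
                _ = 4 * b ^ 2 := by ring
                _ ≤ _ := mul_le_mul_right le_add_self _
            rcases le_total ‖u n θ‖ₑ ‖G θ‖ₑ with h | h
            · exact key _ _ h
            · rw [add_comm, add_comm (‖u n θ‖ₑ ^ 2)]
              exact key _ _ h
        _ ≤ _ := by
            rw [lintegral_const_mul' _ _ (by finiteness),
              lintegral_add_left ((hucont n).enorm.measurable.pow_const 2)]
            gcongr
            · exact huM α n
            · exact hGM α
    · filter_upwards [ae_restrict_of_ae hlim] with θ hθ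
      have := (hθ.sub_const (G θ)).enorm
      simpa using this

/-- Functions in the Morrey space grow at most like `(1-|z|)^{-(1-lam)/2}`. The constant is not
controlled by the norm; only its finiteness is asserted. -/
lemma MemMorrey.exists_norm_le {lam : ℝ} (hlam0 : 0 < lam) (hlam1 : lam < 1) {f : ℂ → ℂ}
    (hf : MemMorrey lam f) :
    ∃ A : ℝ, 0 ≤ A ∧ ∀ z ∈ disc, ‖f z‖ ≤ A * (1 - ‖z‖) ^ (-((1 - lam) / 2)) := by
  have hπ := Real.pi_pos
  obtain ⟨hH, F, hF, hosc⟩ := hf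
  obtain ⟨r, hrmem, hrlim, hGm, ⟨A, hA0, hA⟩, hL1⟩ := exists_boundary_bounds hH hF
  obtain ⟨D, hD0, hD⟩ := exists_lintegral_sub_arcMean_le hosc
  set κ := (1 + lam) / 2 with hκ
  have hκ1 : κ < 1 := by linarith
  have hκ0 : 0 < κ := by linarith
  obtain ⟨C, hC0, hC⟩ := exists_lintegral_arc_le hκ1 hD0 hA0 hD hA hκ0.le
  have hden : 0 < 1 - κ := by linarith
  refine ⟨1 / 2 * (C / (1 - κ)), by positivity, fun z hz => ?_⟩
  have hz1 := mem_disc_iff.1 hz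
  set δ := 1 - ‖z‖ with hδ
  have hδ0 : 0 < δ := by linarith
  set φ := z.arg with hφ
  set s := Set.Ioc (φ - Real.pi) (φ - Real.pi + 2 * Real.pi) with hs
  set u : ℝ → ℝ≥0∞ := fun θ => ‖F (circleMap 0 1 θ)‖ₑ with hu
  have hball : ∀ t : ℝ, 0 < t →
      ∫⁻ θ in s, (Metric.ball φ t).indicator u θ ≤ ENNReal.ofReal (C * t ^ κ) := by
    intro t ht
    rcases le_or_gt t Real.pi with h | h
    · calc ∫⁻ θ in s, (Metric.ball φ t).indicator u θ
          ≤ ∫⁻ θ, (Metric.ball φ t).indicator u θ := setLIntegral_le_lintegral _ _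
        _ = ∫⁻ θ in Metric.ball φ t, u θ := lintegral_indicator Metric.isOpen_ball.measurableSet _
        _ ≤ ∫⁻ θ in Set.Icc (φ - t) (φ - t + 2 * Real.pi * (t / Real.pi)), u θ := by
            refine lintegral_mono_set fun θ hθ => ?_
            rw [Metric.mem_ball, Real.dist_eq, abs_lt] at hθ
            rw [show 2 * Real.pi * (t / Real.pi) = 2 * t by field_simp]
            constructor <;> linarith [hθ.1, hθ.2]
        _ ≤ ENNReal.ofReal (C * (t / Real.pi) ^ κ) :=
            hC _ _ ⟨by positivity, (div_le_one hπ).2 h⟩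
        _ ≤ _ := by
            refine ENNReal.ofReal_le_ofReal (mul_le_mul_of_nonneg_left ?_ hC0)
            exact Real.rpow_le_rpow (by positivity)
              (div_le_self ht.le (by linarith [Real.pi_gt_three])) hκ0.le
    · calc ∫⁻ θ in s, (Metric.ball φ t).indicator u θ ≤ ∫⁻ θ in s, u θ :=
            lintegral_mono (Set.indicator_le_self _ _)
        _ ≤ ∫⁻ θ in Set.Icc (φ - Real.pi) (φ - Real.pi + 2 * Real.pi * 1), u θ := by
            rw [mul_one]
            exact lintegral_mono_set Set.Ioc_subset_Icc_self
        _ ≤ ENNReal.ofReal (C * 1 ^ κ) := hC _ 1 (by norm_num)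
        _ ≤ _ := by
            refine ENNReal.ofReal_le_ofReal (mul_le_mul_of_nonneg_left ?_ hC0)
            exact Real.rpow_le_rpow zero_le_one (by linarith [Real.pi_gt_three]) hκ0.le
  have hK := lintegral_mul_inv_max_le hκ1 hC0 hδ0 (s := s) (u := u)
    hGm.enorm.restrict hball
  set K := ENNReal.ofReal (C * δ ^ (κ - 1) / (1 - κ)) with hKdef
  have hn : ∀ n, ENNReal.ofReal (2 * Real.pi) * ‖f (r n * z)‖ₑ ≤ ENNReal.ofReal Real.pi *
      (K + ENNReal.ofReal (1 / δ) *
        ∫⁻ θ in s, ‖f (circleMap 0 (r n) θ) - F (circleMap 0 1 θ)‖ₑ) := by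
    intro n
    calc ENNReal.ofReal (2 * Real.pi) * ‖f (r n * z)‖ₑ
        ≤ ∫⁻ θ in s, ‖f (circleMap 0 (r n) θ)‖ₑ * ENNReal.ofReal (1 / ‖circleMap 0 1 θ - z‖) :=
          enorm_le_cauchy_lintegral hH.1 (hrmem n) hz (φ - Real.pi)
      _ ≤ ∫⁻ θ in s, ENNReal.ofReal Real.pi * (u θ * ENNReal.ofReal (1 / max δ |θ - φ|) +
            ENNReal.ofReal (1 / δ) * ‖f (circleMap 0 (r n) θ) - F (circleMap 0 1 θ)‖ₑ) := by
          refine setLIntegral_mono' measurableSet_Ioc fun θ hθ => ?_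
          have hθ' : |θ - φ| ≤ Real.pi := by
            rw [abs_le]
            constructor <;> linarith [hθ.1, hθ.2]
          have hmax : 0 < max δ |θ - φ| := lt_max_of_lt_left hδ0
          have h1 := max_le_pi_mul_norm_circleMap_sub hz hθ'
          have h2 : ENNReal.ofReal (1 / ‖circleMap 0 1 θ - z‖) ≤
              ENNReal.ofReal Real.pi * ENNReal.ofReal (1 / max δ |θ - φ|) := by
            rw [← ENNReal.ofReal_mul hπ.le]
            apply ENNReal.ofReal_le_ofReal
            have h3 : 0 < ‖circleMap 0 1 θ - z‖ := by
              by_contra! hle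
              nlinarith
            rw [mul_one_div, div_le_div_iff₀ h3 hmax]
            linarith
          have h4 : ENNReal.ofReal (1 / max δ |θ - φ|) ≤ ENNReal.ofReal (1 / δ) :=
            ENNReal.ofReal_le_ofReal (one_div_le_one_div_of_le hδ0 (le_max_left _ _))
          have h5 : ‖f (circleMap 0 (r n) θ)‖ₑ ≤
              u θ + ‖f (circleMap 0 (r n) θ) - F (circleMap 0 1 θ)‖ₑ := by
            have := enorm_add_le (F (circleMap 0 1 θ))
              (f (circleMap 0 (r n) θ) - F (circleMap 0 1 θ))
            rwa [add_sub_cancel] at this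
          calc _ ≤ (u θ + ‖f (circleMap 0 (r n) θ) - F (circleMap 0 1 θ)‖ₑ) *
                (ENNReal.ofReal Real.pi * ENNReal.ofReal (1 / max δ |θ - φ|)) := mul_le_mul' h5 h2
            _ = ENNReal.ofReal Real.pi * (u θ * ENNReal.ofReal (1 / max δ |θ - φ|) +
                ENNReal.ofReal (1 / max δ |θ - φ|) *
                  ‖f (circleMap 0 (r n) θ) - F (circleMap 0 1 θ)‖ₑ) := by ring
            _ ≤ _ := by gcongr
      _ = ENNReal.ofReal Real.pi * ((∫⁻ θ in s, u θ * ENNReal.ofReal (1 / max δ |θ - φ|)) +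
            ENNReal.ofReal (1 / δ) * ∫⁻ θ in s,
              ‖f (circleMap 0 (r n) θ) - F (circleMap 0 1 θ)‖ₑ) := by
          rw [lintegral_const_mul' _ _ ENNReal.ofReal_ne_top, lintegral_add_left',
            lintegral_const_mul' _ _ ENNReal.ofReal_ne_top]
          exact hGm.enorm.restrict.mul (by fun_prop)
      _ ≤ _ := by gcongr
  have hlim1 : Tendsto (fun n => ENNReal.ofReal (2 * Real.pi) * ‖f (r n * z)‖ₑ) atTop
      (𝓝 (ENNReal.ofReal (2 * Real.pi) * ‖f z‖ₑ)) := by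
    refine ENNReal.Tendsto.const_mul ?_ (Or.inr ENNReal.ofReal_ne_top)
    have h1 : Tendsto (fun n => (r n : ℂ) * z) atTop (𝓝 z) := by
      have := ((Complex.continuous_ofReal.tendsto 1).comp hrlim).mul_const z
      simpa using this
    exact ((hH.1.hasDerivAt hz).continuousAt.tendsto.comp h1).enorm
  have hlim2 : Tendsto (fun n => ENNReal.ofReal Real.pi * (K + ENNReal.ofReal (1 / δ) *
        ∫⁻ θ in s, ‖f (circleMap 0 (r n) θ) - F (circleMap 0 1 θ)‖ₑ)) atTop
      (𝓝 (ENNReal.ofReal Real.pi * (K + ENNReal.ofReal (1 / δ) * 0))) :=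
    ENNReal.Tendsto.const_mul (tendsto_const_nhds.add (ENNReal.Tendsto.const_mul
      (hL1 (φ - Real.pi)) (Or.inr ENNReal.ofReal_ne_top))) (Or.inr ENNReal.ofReal_ne_top)
  have hfin := le_of_tendsto_of_tendsto' hlim1 hlim2 hn
  rw [mul_zero, add_zero, hKdef, ← ofReal_norm, ← ENNReal.ofReal_mul (by positivity),
    ← ENNReal.ofReal_mul hπ.le, ENNReal.ofReal_le_ofReal_iff (by positivity)] at hfin
  rw [show -((1 - lam) / 2) = κ - 1 by rw [hκ]; ring]
  have h6 : 2 * ‖f z‖ ≤ C * δ ^ (κ - 1) / (1 - κ) := by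
    by_contra! hlt
    nlinarith
  calc ‖f z‖ ≤ 1 / 2 * (C * δ ^ (κ - 1) / (1 - κ)) := by linarith
    _ = _ := by ring

/-! ### Comparison of the three quantities -/

/-- On bounded sets of the Morrey space, `T_g` is bounded by the growth of `g'` of order
`(1-|z|)^{-(1+lam)/2}`. -/
lemma blochNorm_volterra_le_derivGrowth {lam : ℝ} (hlam0 : 0 < lam) (hlam1 : lam < 1)
    {g f : ℂ → ℂ} (hg : Holo g) (hf : Holo f) {m : ℝ} (hm : 0 ≤ m)
    (hfm : morreyNorm lam f ≤ ENNReal.ofReal m) :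
    blochNorm (volterra g f) ≤
      ENNReal.ofReal (2 * (1 + 2 ^ ((3 + lam) / 2) / ((1 - lam) / 2)) * m) *
        derivGrowth ((1 + lam) / 2) g := by
  set γ := (1 - lam) / 2 with hγ
  have hγ0 : 0 < γ := by linarith
  set L : ℝ := 2 ^ ((3 + lam) / 2) with hL
  have hL0 : 0 < L := by positivity
  have h0 : ‖f 0‖ ≤ m := by
    rw [← ENNReal.ofReal_le_ofReal_iff hm, ofReal_norm]
    exact le_self_add.trans hfm
  have hbox : boxSeminorm lam 1 f ≤ ENNReal.ofReal m := le_add_self.trans hfm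
  have hgrowth : derivGrowth (γ + 1) f ≤ ENNReal.ofReal (L * m) := by
    have h1 := derivGrowth_le_boxSeminorm hlam0.le zero_le_one hf
    rw [show (1 + 2 - lam) / 2 = γ + 1 by rw [hγ]; ring,
      show (1 + 2 + lam) / 2 = (3 + lam) / 2 by ring] at h1
    rw [ENNReal.ofReal_mul hL0.le]
    exact h1.trans (mul_le_mul_right hbox _)
  have hbd : ∀ z ∈ disc, ‖f z‖ ≤ (1 + L / γ) * m * (1 - ‖z‖) ^ (-γ) := by
    intro z hz
    have hz1 := mem_disc_iff.1 hz
    have h2 := norm_le_of_derivGrowth_le hγ0 (by positivity) hf hgrowth hz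
    have h3 : 1 ≤ (1 - ‖z‖) ^ (-γ) :=
      Real.one_le_rpow_of_pos_of_le_one_of_nonpos (by linarith) (by linarith [norm_nonneg z])
        (by linarith)
    calc ‖f z‖ ≤ ‖f 0‖ + L * m / γ * (1 - ‖z‖) ^ (-γ) := h2
      _ ≤ m * (1 - ‖z‖) ^ (-γ) + L * m / γ * (1 - ‖z‖) ^ (-γ) := by
          gcongr
          exact h0.trans (le_mul_of_one_le_right hm h3)
      _ = _ := by ring
  have := blochNorm_volterra_le (by positivity) hg hf hbd
  rwa [show 1 - γ = (1 + lam) / 2 by rw [hγ]; ring, ← mul_assoc] at this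

lemma volterraNorm_le_derivGrowth {lam : ℝ} (hlam0 : 0 < lam) (hlam1 : lam < 1) {g : ℂ → ℂ}
    (hg : Holo g) :
    volterraNorm lam g ≤
      ENNReal.ofReal (2 * (1 + 2 ^ ((3 + lam) / 2) / ((1 - lam) / 2))) *
        derivGrowth ((1 + lam) / 2) g := by
  refine iSup_le fun f => iSup₂_le fun hf hf1 => ?_
  have := blochNorm_volterra_le_derivGrowth hlam0 hlam1 hg hf.1.1 zero_le_one
    (by rwa [ENNReal.ofReal_one])
  rwa [mul_one] at this

lemma volterraBounded_of_derivGrowth_lt_top {lam : ℝ} (hlam0 : 0 < lam) (hlam1 : lam < 1)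
    {g : ℂ → ℂ} (hg : Holo g) (h : derivGrowth ((1 + lam) / 2) g < ∞) : VolterraBounded lam g := by
  set n := (derivGrowth ((1 + lam) / 2) g).toReal with hn
  have hn' : derivGrowth ((1 + lam) / 2) g = ENNReal.ofReal n := (ENNReal.ofReal_toReal h.ne).symm
  have hn0 : 0 ≤ n := ENNReal.toReal_nonneg
  set C : ℝ := 2 * (1 + 2 ^ ((3 + lam) / 2) / ((1 - lam) / 2)) with hC
  have hC0 : 0 ≤ C := by
    have : 0 < 1 - lam := by linarith
    positivity
  refine ⟨fun f hf => ⟨holo_volterra hg hf.1.1, ?_⟩, C * n + 1, by positivity, fun f hf => ?_⟩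
  · obtain ⟨A, hA0, hA⟩ := hf.exists_norm_le hlam0 hlam1
    have h1 := blochNorm_volterra_le hA0 hg hf.1.1 hA
    rw [show 1 - (1 - lam) / 2 = (1 + lam) / 2 by ring, hn'] at h1
    exact (le_add_self.trans h1).trans_lt (by finiteness)
  · -- Elements of the Morrey space are not assumed to have finite norm; if the norm is infinite,
    -- the right-hand side is infinite because the constant is positive.
    rcases eq_or_ne (morreyNorm lam f) ∞ with htop | htop
    · rw [htop, ENNReal.mul_top]
      · exact le_top
      · rw [ne_eq, ENNReal.ofReal_eq_zero, not_le]
        positivity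
    · set m := (morreyNorm lam f).toReal with hm
      have hm' : morreyNorm lam f = ENNReal.ofReal m := (ENNReal.ofReal_toReal htop).symm
      have hm0 : 0 ≤ m := ENNReal.toReal_nonneg
      have h1 := blochNorm_volterra_le_derivGrowth hlam0 hlam1 hg hf.1.1 hm0 hm'.le
      refine h1.trans ?_
      rw [hn', hm', ← ENNReal.ofReal_mul (by positivity), ← ENNReal.ofReal_mul (by positivity)]
      apply ENNReal.ofReal_le_ofReal
      rw [← hC]
      nlinarith

lemma volterraNorm_lt_top {lam : ℝ} {g : ℂ → ℂ} (h : VolterraBounded lam g) :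
    volterraNorm lam g < ∞ := by
  obtain ⟨-, C, -, hC⟩ := h
  refine lt_of_le_of_lt (iSup_le fun f => iSup₂_le fun hf hf1 => ?_)
    (ENNReal.ofReal_lt_top (r := C))
  exact (hC f hf).trans (mul_le_of_le_one_right' hf1)

lemma blochMorreyM_le_derivGrowth {p lam : ℝ} (hlam1 : lam < 1) (hp : 1 < p) (g : ℂ → ℂ) :
    blochMorreyM p lam g ≤
      ENNReal.ofReal (√(2 * 2 ^ p / (p - lam))) * derivGrowth ((1 + lam) / 2) g := by
  have h := boxSeminorm_le_derivGrowth (b := (1 + lam) / 2) (q := p) (by linarith) (by linarith) g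
  rwa [show p - 2 * ((1 + lam) / 2) + 2 = p - lam + 1 by ring,
    show p - 2 * ((1 + lam) / 2) + 1 = p - lam by ring] at h

lemma derivGrowth_le_blochMorreyM {p lam : ℝ} (hlam1 : lam < 1) (hp : 1 < p) {g : ℂ → ℂ}
    (hg : Holo g) :
    derivGrowth ((1 + lam) / 2) g ≤
      ENNReal.ofReal (2 ^ ((2 * p + 3 - lam) / 2)) * blochMorreyM p lam g := by
  have h := derivGrowth_le_boxSeminorm (s := p - lam + 1) (q := p) (by linarith) (by linarith) hg
  rwa [show (p + 2 - (p - lam + 1)) / 2 = (1 + lam) / 2 by ring,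
    show (p + 2 + (p - lam + 1)) / 2 = (2 * p + 3 - lam) / 2 by ring] at h

end MorreyBloch

end

theorem mainTheorem1 (lam : ℝ) (hlam0 : 0 < lam) (hlam1 : lam < 1) :
    (∀ g : ℂ → ℂ, MorreyBloch.Holo g →
      List.TFAE
        [MorreyBloch.VolterraBounded lam g,
         ∀ p : ℝ, 1 < p → MorreyBloch.MemBlochMorrey p lam g,
         ∃ p : ℝ, 1 < p ∧ MorreyBloch.MemBlochMorrey p lam g]) ∧
    (∀ p : ℝ, 1 < p → ∃ c C : ℝ, 0 < c ∧ 0 < C ∧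
      ∀ g : ℂ → ℂ, MorreyBloch.Holo g →
        ENNReal.ofReal c * MorreyBloch.blochMorreyM p lam g ≤ MorreyBloch.volterraNorm lam g ∧
        MorreyBloch.volterraNorm lam g ≤ ENNReal.ofReal C * MorreyBloch.blochMorreyM p lam g) := by
  have hlam2 : 0 < 1 - lam := by linarith
  refine ⟨fun g hg => ?_, fun p hp => ?_⟩
  · tfae_have 1 → 2 := by
      intro h p hp
      have h1 := (MorreyBloch.derivGrowth_le_volterraNorm hlam0 hlam1 hg).trans_lt
        (ENNReal.mul_lt_top ENNReal.ofReal_lt_top (MorreyBloch.volterraNorm_lt_top h))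
      exact ⟨hg, (MorreyBloch.blochMorreyM_le_derivGrowth hlam1 hp g).trans_lt
        (ENNReal.mul_lt_top ENNReal.ofReal_lt_top h1)⟩
    tfae_have 2 → 3 := fun h => ⟨2, one_lt_two, h 2 one_lt_two⟩
    tfae_have 3 → 1 := by
      rintro ⟨p, hp, -, h⟩
      exact MorreyBloch.volterraBounded_of_derivGrowth_lt_top hlam0 hlam1 hg
        ((MorreyBloch.derivGrowth_le_blochMorreyM hlam1 hp hg).trans_lt
          (ENNReal.mul_lt_top ENNReal.ofReal_lt_top h))
    tfae_finish
  · have hp2 : 0 < p - lam := by linarith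
    set a : ℝ := √(2 * 2 ^ p / (p - lam)) * (2 * (1 + √(12 / lam * (4 / lam + 2)))) with ha
    have ha0 : 0 < a := by positivity
    refine ⟨a⁻¹, 2 * (1 + 2 ^ ((3 + lam) / 2) / ((1 - lam) / 2)) * 2 ^ ((2 * p + 3 - lam) / 2),
      by positivity, by positivity, fun g hg => ⟨?_, ?_⟩⟩
    · have h1 := (MorreyBloch.blochMorreyM_le_derivGrowth hlam1 hp g).trans
        (mul_le_mul_right (MorreyBloch.derivGrowth_le_volterraNorm hlam0 hlam1 hg) _)
      rw [← mul_assoc, ← ENNReal.ofReal_mul (by positivity), ← ha] at h1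
      refine (mul_le_mul_right h1 _).trans (le_of_eq ?_)
      rw [← mul_assoc, ← ENNReal.ofReal_mul (by positivity), inv_mul_cancel₀ ha0.ne',
        ENNReal.ofReal_one, one_mul]
    · have h1 := (MorreyBloch.volterraNorm_le_derivGrowth hlam0 hlam1 hg).trans
        (mul_le_mul_right (MorreyBloch.derivGrowth_le_blochMorreyM hlam1 hp hg) _)
      rwa [← mul_assoc, ← ENNReal.ofReal_mul (by positivity)] at h1
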